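/- Let $S^3\subset\mathbb{R}^4=\mathbb{C}^2$ be the unit sphere with its standard tight contact structure $\xi_0=TS^3\cap iTS^3$. For a contact form $\alpha$ on $S^3$ with $\ker\alpha=\xi_0$, the Reeb flow $\varphi_t$ of $\alpha$ is the flow of the vector field $R$ determined by $\alpha(R)=1$ and $\iota_R d\alpha=0$. A global surface of section for $\varphi_t$ is a smoothly embedded, compact, connected surface $S\subset S^3$ (possibly with boundary) such that (i) the boundary $\partial S$ consists of periodic orbits of $\varphi_t$; (ii) $R$ is transverse to the interior $\mathring S$ of $S$; (iii) for every $x\in S^3\setminus\partial S$ there are $t_+>0$ and $t_-<0$ with $\varphi_{t_+}(x)\in\mathring S$ and $\varphi_{t_-}(x)\in\mathring S$. It is called disk-like if $S$ is diffeomorphic to the closed disk. Theorem. There is a smooth contact form $\alpha$ on $S^3$ with $\ker\alpha=\xi_0$ whose Reeb flow admits no global surface of section with exactly one boundary component. In particular, this Reeb flow admits no disk-like global surface of section. -/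

import Mathlib

open Set Metric Manifold
open scoped ContDiff RealInnerProductSpace

/-- The unit three-sphere in `ℝ⁴ = ℂ²`, with coordinates `(x 0 + i x 1, x 2 + i x 3)`. It carries
Mathlib's smooth structure, modelled on `EuclideanSpace ℝ (Fin 3)`. -/
abbrev ThreeSphere : Type := sphere (0 : EuclideanSpace ℝ (Fin 4)) 1

/-- The tangent space of the three-sphere at `x`, as a subspace of `ℝ⁴`. -/
noncomputable def tangentPlane (x : ThreeSphere) : Submodule ℝ (EuclideanSpace ℝ (Fin 4)) :=
  (Submodule.span ℝ {(x : EuclideanSpace ℝ (Fin 4))})ᗮ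

/-- The standard complex structure on `ℝ⁴ = ℂ²` (multiplication by `i`). -/
noncomputable def mulI (x : EuclideanSpace ℝ (Fin 4)) : EuclideanSpace ℝ (Fin 4) :=
  !₂[-x 1, x 0, -x 3, x 2]

/-- The standard (tight) contact structure on the three-sphere, i.e. the plane field of complex
tangencies: at `x` it consists of the tangent vectors `v` in the kernel of
`x₀ dx₁ - x₁ dx₀ + x₂ dx₃ - x₃ dx₂`, which is the real inner product with `i x`. -/
def standardContactPlane (x : ThreeSphere) : Set (EuclideanSpace ℝ (Fin 4)) :=
  {v | v ∈ tangentPlane x ∧ ⟪mulI x, v⟫ = 0}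

/-- The smooth one-form `α` on `ℝ⁴` restricts to a contact form on the three-sphere: at each point
the restriction of `α` to the tangent space is nonzero, and `dα` is nondegenerate on its kernel
(equivalently, `α ∧ dα` is a volume form on the three-sphere). Every smooth one-form on the
three-sphere is the restriction of a smooth one-form on `ℝ⁴`, and the exterior derivative commutes
with the restriction. -/
structure IsContactFormOnSphere
    (α : EuclideanSpace ℝ (Fin 4) → EuclideanSpace ℝ (Fin 4) [⋀^Fin 1]→L[ℝ] ℝ) : Prop where
  smooth : ContDiff ℝ ∞ α
  ne_zero : ∀ x : ThreeSphere, ∃ v ∈ tangentPlane x, α x ![v] ≠ 0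
  nondegenerate : ∀ x : ThreeSphere, ∀ u ∈ tangentPlane x, α x ![u] = 0 → u ≠ 0 →
    ∃ v ∈ tangentPlane x, α x ![v] = 0 ∧ extDeriv α x ![u, v] ≠ 0

/-- `R` is the Reeb vector field on the three-sphere of (the restriction of) the one-form `α`:
it is tangent to the sphere, `α(R) = 1`, and `dα(R, v) = 0` for all tangent vectors `v`. -/
structure IsReebVectorField
    (α : EuclideanSpace ℝ (Fin 4) → EuclideanSpace ℝ (Fin 4) [⋀^Fin 1]→L[ℝ] ℝ)
    (R : ThreeSphere → EuclideanSpace ℝ (Fin 4)) : Prop where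
  tangent : ∀ x : ThreeSphere, R x ∈ tangentPlane x
  normalized : ∀ x : ThreeSphere, α x ![R x] = 1
  kernel : ∀ x : ThreeSphere, ∀ v ∈ tangentPlane x, extDeriv α x ![R x, v] = 0

/-- `φ` is the flow on the three-sphere generated by the vector field `R`. -/
def IsFlowOf (R : ThreeSphere → EuclideanSpace ℝ (Fin 4)) (φ : Flow ℝ ThreeSphere) : Prop :=
  ∀ (x : ThreeSphere) (t : ℝ),
    HasDerivAt (fun s : ℝ ↦ (φ s x : EuclideanSpace ℝ (Fin 4))) (R (φ t x)) t

/-- The embedded surface `S = f(M)` in the three-sphere, where `M` is a compact connected smooth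
surface, possibly with boundary, is a global surface of section for the flow `φ` of the vector
field `R`. -/
structure IsGlobalSurfaceOfSection
    (R : ThreeSphere → EuclideanSpace ℝ (Fin 4)) (φ : Flow ℝ ThreeSphere)
    (M : Type) [TopologicalSpace M] [ChartedSpace (EuclideanHalfSpace 2) M]
    [IsManifold (𝓡∂ 2) ∞ M] [CompactSpace M] [ConnectedSpace M] (f : M → ThreeSphere) : Prop where
  embedding : IsSmoothEmbedding (𝓡∂ 2) (𝓡 3) ∞ f
  /-- the boundary of the surface consists of periodic orbits -/
  boundary_periodic : ∀ p ∈ (𝓡∂ 2).boundary M,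
    (∃ T : ℝ, 0 < T ∧ φ T (f p) = f p) ∧ ∀ t : ℝ, φ t (f p) ∈ f '' (𝓡∂ 2).boundary M
  /-- the vector field is transverse to the interior of the surface -/
  transverse : ∀ p ∈ (𝓡∂ 2).interior M, ∀ v : TangentSpace (𝓡∂ 2) p,
    mfderiv (𝓡∂ 2) 𝓘(ℝ, EuclideanSpace ℝ (Fin 4))
      (fun q ↦ (f q : EuclideanSpace ℝ (Fin 4))) p v ≠ R (f p)
  /-- every orbit off the boundary hits the interior in forward time -/
  hits_forward : ∀ x ∉ f '' (𝓡∂ 2).boundary M, ∃ t > 0, φ t x ∈ f '' (𝓡∂ 2).interior M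
  /-- every orbit off the boundary hits the interior in backward time -/
  hits_backward : ∀ x ∉ f '' (𝓡∂ 2).boundary M, ∃ t < 0, φ t x ∈ f '' (𝓡∂ 2).interior M

/-- The surface `M` has exactly one boundary component. -/
def HasOneBoundaryComponent (M : Type) [TopologicalSpace M]
    [ChartedSpace (EuclideanHalfSpace 2) M] : Prop :=
  IsConnected ((𝓡∂ 2).boundary M)

/-- The surface `M` is a disk: there is a smooth bijection with everywhere invertible differential
(that is, a diffeomorphism) from the closed unit disk onto `M`. -/
def IsDiskLike (M : Type) [TopologicalSpace M] [ChartedSpace (EuclideanHalfSpace 2) M] : Prop :=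
  ∃ g : EuclideanSpace ℝ (Fin 2) → M,
    ContMDiffOn 𝓘(ℝ, EuclideanSpace ℝ (Fin 2)) (𝓡∂ 2) ∞ g (closedBall 0 1) ∧
    BijOn g (closedBall 0 1) univ ∧
    ∀ x ∈ closedBall (0 : EuclideanSpace ℝ (Fin 2)) 1, Function.Bijective
      (mfderivWithin 𝓘(ℝ, EuclideanSpace ℝ (Fin 2)) (𝓡∂ 2) g (closedBall 0 1) x)

/-! The contact form is a toric rescaling of the standard one, by a function of `m = |z₁|² - |z₂|²`.
Its Reeb flow preserves `m` and rotates the two complex coordinates with speeds depending only on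
`m`. The rescaling is chosen so that the speed of `z₁` vanishes at `m = 1/3` and, symmetrically,
that of `z₂` vanishes at `m = -1/3`. On these levels there are periodic orbits that move in one
coordinate only. One of them bounds a disk inside `m ≥ 1/3` (`upperDisk`), another a disk inside `m
≤ -1/3` (`lowerDisk`).

A global surface of section obstructs such disks. Over the complement of its boundary, the pairs
(point, time at which its orbit hits the surface) form a covering space, since hitting times are
isolated and depend continuously on the point (`isCoveringMap_proj`). Going once around an orbit of
period `T` lifts to a path that shifts the hitting time by `-T`, so a periodic orbit is not
null-homotopic there (`not_nullhomotopic`). Hence each of the two disks meets the boundary of the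
surface (`exists_disk_mem_boundary`).

The boundary consists of orbits, so `m` is locally constant on it; if it is connected, it lies on a
single level (`exists_moment_eq`). That level would have to be both at least `1/3` and at most
`-1/3`. The disk-like case follows because the boundary of a disk is a circle. -/

open Filter Topology

/-! ### Topological sections of a flow and the covering by hitting times -/

/-- A closed set `H` that is crossed transversally by the orbits of the flow `φ`, in the
topological sense, and that every orbit meets in forward and in backward time. -/
structure IsTopologicalSection {X : Type*} [TopologicalSpace X] (φ : Flow ℝ X) (H : Set X) :
    Prop where
  isClosed : IsClosed H
  flowBox : ∀ x ∈ H, ∃ ε > 0, ∃ τ : X → ℝ, (∀ᶠ y in 𝓝 x, ContinuousAt τ y) ∧ τ x = 0 ∧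
    ∀ᶠ y in 𝓝 x, |τ y| < ε ∧ ∀ t : ℝ, |t| < ε → (φ t y ∈ H ↔ t = τ y)
  forward : ∀ x, ∃ t > 0, φ t x ∈ H
  backward : ∀ x, ∃ t < 0, φ t x ∈ H

namespace IsTopologicalSection

variable {X : Type*} [TopologicalSpace X] {φ : Flow ℝ X} {H : Set X}

/-- Time reversal exchanges next and previous hits, so the inverse of the shift and its continuity
come from the forward case. -/
lemma reverse (h : IsTopologicalSection φ H) : IsTopologicalSection φ.reverse H where
  isClosed := h.isClosed
  flowBox x hx := by
    obtain ⟨ε, hε, τ, hc, h0, hτ⟩ := h.flowBox x hx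
    refine ⟨ε, hε, fun y ↦ -τ y, hc.mono fun y hy ↦ hy.neg, by simp [h0], ?_⟩
    filter_upwards [hτ] with y hy
    refine ⟨by simpa using hy.1, fun t ht ↦ ?_⟩
    rw [Flow.reverse_apply, hy.2 (-t) (by simpa using ht), neg_eq_iff_eq_neg]
  forward x := by
    obtain ⟨t, ht, hx⟩ := h.backward x
    exact ⟨-t, by simpa using ht, by simpa using hx⟩
  backward x := by
    obtain ⟨t, ht, hx⟩ := h.forward x
    exact ⟨-t, by simpa using ht, by simpa using hx⟩

/-- The flow box around a point whose orbit hits the section at time `s`. -/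
lemma flowBox_at (h : IsTopologicalSection φ H) {x : X} {s : ℝ} (hs : φ s x ∈ H) :
    ∃ ε > 0, ∃ τ : X → ℝ, (∀ᶠ y in 𝓝 x, ContinuousAt τ y) ∧ τ x = s ∧
      ∀ᶠ y in 𝓝 x, |τ y - s| < ε ∧ ∀ t : ℝ, |t - s| < ε → (φ t y ∈ H ↔ t = τ y) := by
  obtain ⟨ε, hε, τ, hc, h0, hτ⟩ := h.flowBox _ hs
  have hφ : Continuous (fun y ↦ φ s y) := by fun_prop
  refine ⟨ε, hε, fun y ↦ τ (φ s y) + s, ?_, by simp [h0], ?_⟩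
  · filter_upwards [hφ.continuousAt.eventually hc] with y hy
    exact (hy.comp (f := fun y ↦ φ s y) hφ.continuousAt).add continuousAt_const
  · filter_upwards [hφ.continuousAt.eventually hτ] with y hy
    refine ⟨by simpa using hy.1, fun t ht ↦ ?_⟩
    have := hy.2 (t - s) ht
    rw [← Flow.map_add, sub_add_cancel] at this
    rw [this]
    constructor <;> intro h <;> linarith

lemma isClosed_times (h : IsTopologicalSection φ H) (x : X) : IsClosed {t : ℝ | φ t x ∈ H} :=
  h.isClosed.preimage (by fun_prop : Continuous fun t : ℝ ↦ φ t x)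

/-- There is a first hitting time after any hitting time. -/
lemma exists_next (h : IsTopologicalSection φ H) {x : X} {s : ℝ} (hs : φ s x ∈ H) :
    ∃ t, IsLeast {t : ℝ | φ t x ∈ H ∧ s < t} t := by
  obtain ⟨ε, hε, τ, -, h0, hτ⟩ := h.flowBox_at hs
  have hx := hτ.self_of_nhds.2
  obtain ⟨t, ht, hxt⟩ := h.forward (φ s x)
  rw [← Flow.map_add] at hxt
  -- The flow box leaves a gap after `s`, so the later hits form a closed set and their infimum is
  -- attained.
  have key : {t : ℝ | φ t x ∈ H ∧ s < t} = {t : ℝ | φ t x ∈ H} ∩ Ici (s + ε) := by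
    ext t
    simp only [mem_ofPred_eq, mem_inter_iff, mem_Ici]
    refine and_congr_right fun h1 ↦ ⟨fun h2 ↦ ?_, fun h2 ↦ by linarith⟩
    by_contra! h3
    have := (hx t (by rw [abs_lt]; constructor <;> linarith)).1 h1
    linarith
  rw [key]
  refine ⟨_, ((h.isClosed_times x).inter isClosed_Ici).isLeast_csInf ⟨t + s, ?_⟩
    ⟨s + ε, fun _ h ↦ h.2⟩⟩
  rw [← key]
  exact ⟨hxt, by linarith⟩

variable (φ H) in
/-- The space of hitting times of the section `H`. -/
abbrev HittingTimes : Type _ := {p : X × ℝ // φ p.2 p.1 ∈ H}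

/-- The next hitting time, as a self-map of the space of hitting times. -/
noncomputable def next (h : IsTopologicalSection φ H) (z : HittingTimes φ H) : HittingTimes φ H :=
  ⟨(z.1.1, (h.exists_next z.2).choose), (h.exists_next z.2).choose_spec.1.1⟩

@[simp] lemma next_fst (h : IsTopologicalSection φ H) (z : HittingTimes φ H) :
    (h.next z).1.1 = z.1.1 := rfl

lemma isLeast_next (h : IsTopologicalSection φ H) (z : HittingTimes φ H) :
    IsLeast {t : ℝ | φ t z.1.1 ∈ H ∧ z.1.2 < t} (h.next z).1.2 :=
  (h.exists_next z.2).choose_spec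

/-- Flow boxes at the current hit and at the next one, with no hits in the compact interval between
them, persist for nearby orbits. Hence the next hitting time is locally the continuous function `τ'`
of the second box. -/
lemma continuous_next (h : IsTopologicalSection φ H) : Continuous h.next := by
  rw [continuous_iff_continuousAt]
  rintro ⟨⟨x, s⟩, hs⟩
  set z : HittingTimes φ H := ⟨(x, s), hs⟩ with hz
  have hl := h.isLeast_next z
  set s' := (h.next z).1.2 with hs'
  have hls : s < s' := hl.1.2
  obtain ⟨ε, hε, τ, -, h0, hτ⟩ := h.flowBox_at hs
  obtain ⟨ε', hε', τ', hc', h0', hτ'⟩ := h.flowBox_at (x := x) (h.next z).2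
  have hfst : Tendsto (fun w : HittingTimes φ H ↦ w.1.1) (𝓝 z) (𝓝 x) :=
    (continuous_fst.comp continuous_subtype_val).tendsto z
  have hsnd : Tendsto (fun w : HittingTimes φ H ↦ w.1.2) (𝓝 z) (𝓝 s) :=
    (continuous_snd.comp continuous_subtype_val).tendsto z
  -- no hits in the middle
  have hmid : ∀ᶠ y in 𝓝 x, ∀ t ∈ Icc (s + ε / 2) (s' - ε' / 2), φ t y ∉ H := by
    refine isCompact_Icc.eventually_forall_of_forall_eventually fun t ht ↦ ?_
    have hopen : IsOpen {p : X × ℝ | φ p.2 p.1 ∉ H} :=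
      h.isClosed.isOpen_compl.preimage (by fun_prop : Continuous fun p : X × ℝ ↦ φ p.2 p.1)
    refine hopen.mem_nhds fun hh ↦ ?_
    have := hl.2 ⟨hh, show s < t by linarith [ht.1]⟩
    linarith [ht.2]
  -- The bound by half of `s' - s` keeps `τ' y` above the midpoint of `s` and `s'`; the bound `hss`
  -- keeps the starting time below it. So `τ'` gives a later hit.
  have hτc : ∀ᶠ y in 𝓝 x, |τ' y - s'| < min ε' (s' - s) / 2 := by
    have : Tendsto τ' (𝓝 x) (𝓝 s') := by
      have := hc'.self_of_nhds
      rwa [ContinuousAt, h0'] at this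
    have h2 := this.sub_const s'
    rw [sub_self] at h2
    have hp : 0 < min ε' (s' - s) / 2 := by
      have := lt_min hε' (sub_pos.2 hls); linarith
    simpa using h2.abs.eventually (gt_mem_nhds (by simpa using hp))
  have key : ∀ᶠ w in 𝓝 z, (h.next w).1.2 = τ' w.1.1 := by
    have hss : ∀ᶠ w in 𝓝 z, |w.1.2 - s| < min ε (s' - s) / 2 := by
      have h2 := hsnd.sub_const s
      rw [sub_self] at h2
      have hp : 0 < min ε (s' - s) / 2 := by
        have := lt_min hε (sub_pos.2 hls); linarith
      simpa using h2.abs.eventually (gt_mem_nhds (by simpa using hp))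
    filter_upwards [hfst.eventually hmid, hfst.eventually hτ, hfst.eventually hτ',
      hfst.eventually hτc, hss] with w h1 h2 h3 h4 h5
    have hm1 := min_le_left ε (s' - s)
    have hm2 := min_le_right ε (s' - s)
    have hm3 := min_le_left ε' (s' - s)
    have hm4 := min_le_right ε' (s' - s)
    rw [abs_lt] at h4 h5
    have hlw := h.isLeast_next w
    have hτH : φ (τ' w.1.1) w.1.1 ∈ H := (h3.2 _ h3.1).2 rfl
    have hle : (h.next w).1.2 ≤ τ' w.1.1 := hlw.2 ⟨hτH, by linarith⟩
    have hws : w.1.2 = τ w.1.1 :=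
      (h2.2 _ (by rw [abs_lt]; constructor <;> linarith)).1 w.2
    -- An earlier next hit would be a second hit in the window around `s`, which contains only one.
    have hge : s + ε / 2 ≤ (h.next w).1.2 := by
      by_contra! hlt
      have := (h2.2 _ (by rw [abs_lt]; constructor <;> linarith [hlw.1.2])).1 hlw.1.1
      exact absurd hlw.1.2 (by rw [this, hws]; exact lt_irrefl _)
    have hgt : s' - ε' / 2 < (h.next w).1.2 := by
      by_contra! hlt
      exact h1 _ ⟨hge, hlt⟩ hlw.1.1
    exact (h3.2 _ (by rw [abs_lt]; constructor <;> linarith)).1 hlw.1.1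
  refine (IsInducing.subtypeVal.continuousAt_iff (f := h.next)).2 ?_
  refine ContinuousAt.prodMk hfst ?_
  have : ContinuousAt (fun w : HittingTimes φ H ↦ τ' w.1.1) z :=
    ContinuousAt.comp (f := fun w : HittingTimes φ H ↦ w.1.1) (by exact hc'.self_of_nhds) hfst
  exact this.congr (key.mono fun _ h ↦ h.symm)

/-- The previous hitting time, as a self-map of the space of hitting times. -/
noncomputable def prev (h : IsTopologicalSection φ H) (z : HittingTimes φ H) : HittingTimes φ H :=
  ⟨(z.1.1, -(h.reverse.next ⟨(z.1.1, -z.1.2), by simpa using z.2⟩).1.2),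
    (h.reverse.next ⟨(z.1.1, -z.1.2), by simpa using z.2⟩).2⟩

@[simp] lemma prev_fst (h : IsTopologicalSection φ H) (z : HittingTimes φ H) :
    (h.prev z).1.1 = z.1.1 := rfl

lemma isGreatest_prev (h : IsTopologicalSection φ H) (z : HittingTimes φ H) :
    IsGreatest {t : ℝ | φ t z.1.1 ∈ H ∧ t < z.1.2} (h.prev z).1.2 := by
  have hl := h.reverse.isLeast_next ⟨(z.1.1, -z.1.2), by simpa using z.2⟩
  refine ⟨⟨(h.prev z).2, neg_lt.1 hl.1.2⟩, fun t ht ↦ ?_⟩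
  exact le_neg.1 (hl.2 ⟨by simpa using ht.1, by simpa using ht.2⟩)

lemma continuous_prev (h : IsTopologicalSection φ H) : Continuous h.prev := by
  refine Continuous.subtype_mk (Continuous.prodMk (by fun_prop) (Continuous.neg ?_)) _
  refine (continuous_snd.comp continuous_subtype_val).comp (h.reverse.continuous_next.comp ?_)
  exact Continuous.subtype_mk (by fun_prop) _

lemma next_prev (h : IsTopologicalSection φ H) (z : HittingTimes φ H) : h.next (h.prev z) = z := by
  refine Subtype.ext (Prod.ext rfl ?_)
  have h1 := h.isLeast_next (h.prev z)
  have h2 := h.isGreatest_prev z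
  refine le_antisymm (h1.2 ⟨z.2, h2.1.2⟩) ?_
  by_contra! h3
  exact absurd h1.1.2 (not_lt.2 (h2.2 ⟨h1.1.1, h3⟩))

lemma prev_next (h : IsTopologicalSection φ H) (z : HittingTimes φ H) : h.prev (h.next z) = z := by
  refine Subtype.ext (Prod.ext rfl ?_)
  have h1 := h.isLeast_next z
  have h2 := h.isGreatest_prev (h.next z)
  refine le_antisymm ?_ (h2.2 ⟨z.2, h1.1.2⟩)
  by_contra! h3
  exact absurd h2.1.2 (not_lt.2 (h1.2 ⟨h2.1.1, h3⟩))

/-- The next hitting time, as a permutation of the space of hitting times. -/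
noncomputable def nextPerm (h : IsTopologicalSection φ H) : Equiv.Perm (HittingTimes φ H) where
  toFun := h.next
  invFun := h.prev
  left_inv := h.prev_next
  right_inv := h.next_prev

lemma nextPerm_zpow_fst (h : IsTopologicalSection φ H) (n : ℤ) (z : HittingTimes φ H) :
    ((h.nextPerm ^ n) z).1.1 = z.1.1 := by
  induction n generalizing z with
  | zero => simp
  | succ n ih => rw [zpow_add_one, Equiv.Perm.mul_apply, ih]; rfl
  | pred n ih => rw [zpow_sub_one, Equiv.Perm.mul_apply, ih]; rfl

lemma continuous_nextPerm_zpow (h : IsTopologicalSection φ H) (n : ℤ) :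
    Continuous (h.nextPerm ^ n) := by
  induction n with
  | zero => simpa using continuous_id
  | succ n ih => rw [zpow_add_one]; exact ih.comp h.continuous_next
  | pred n ih => rw [zpow_sub_one]; exact ih.comp h.continuous_prev

lemma strictMono_nextPerm_zpow (h : IsTopologicalSection φ H) (z : HittingTimes φ H) :
    StrictMono fun n : ℤ ↦ ((h.nextPerm ^ n) z).1.2 := by
  refine strictMono_int_of_lt_succ fun n ↦ ?_
  rw [add_comm, zpow_one_add, Equiv.Perm.mul_apply]
  exact (h.isLeast_next _).1.2

/-- Hits cannot accumulate: a limit of increasing hitting times is a hitting time because `H` is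
closed, and its flow box contains no other. -/
lemma exists_lt_nextPerm_zpow (h : IsTopologicalSection φ H) (z : HittingTimes φ H) (T : ℝ) :
    ∃ n : ℕ, T < ((h.nextPerm ^ (n : ℤ)) z).1.2 := by
  by_contra! hT
  set u : ℕ → ℝ := fun n ↦ ((h.nextPerm ^ (n : ℤ)) z).1.2 with hu
  have hmono : StrictMono u := (h.strictMono_nextPerm_zpow z).comp Nat.strictMono_cast
  have hH : ∀ n, φ (u n) z.1.1 ∈ H := fun n ↦ by
    have := ((h.nextPerm ^ (n : ℤ)) z).2
    rwa [h.nextPerm_zpow_fst] at this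
  have hlim := tendsto_atTop_ciSup hmono.monotone ⟨T, by rintro _ ⟨n, rfl⟩; exact hT n⟩
  set L := ⨆ n, u n
  have hL : φ L z.1.1 ∈ H :=
    (h.isClosed_times z.1.1).mem_of_tendsto hlim (Eventually.of_forall hH)
  obtain ⟨ε, hε, τ, -, h0, hτ⟩ := h.flowBox_at hL
  have huniq := hτ.self_of_nhds.2
  obtain ⟨n, hn⟩ := (hlim.eventually (Metric.ball_mem_nhds L hε)).exists
  have h1 := (huniq _ (by simpa [Real.dist_eq] using hn)).1 (hH n)
  have h2 := hmono (Nat.lt_succ_self n)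
  have h3 := hmono.monotone.ge_of_tendsto hlim (n + 1)
  rw [h1, h0] at h2
  exact absurd h2 (not_lt.2 h3)

/-- Take the last iterate of `z` not exceeding `w`; if it were smaller than `w`, the following
iterate, being the least later hit, would not exceed `w` either. This makes the shift transitive on
fibres. -/
lemma exists_nextPerm_zpow_eq_of_le (h : IsTopologicalSection φ H) {z w : HittingTimes φ H}
    (hzw : z.1.1 = w.1.1) (hle : z.1.2 ≤ w.1.2) : ∃ n : ℤ, (h.nextPerm ^ n) z = w := by
  have hex := h.exists_lt_nextPerm_zpow z w.1.2
  classical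
  have hn := Nat.find_spec hex
  have hmin := fun m => Nat.find_min hex (m := m)
  set n := Nat.find hex
  obtain ⟨k, hk⟩ : ∃ k, n = k + 1 := by
    refine Nat.exists_eq_succ_of_ne_zero fun h0 ↦ ?_
    rw [h0] at hn
    simp at hn
    linarith
  refine ⟨k, Subtype.ext (Prod.ext (by rw [h.nextPerm_zpow_fst, hzw]) ?_)⟩
  have h1 := not_lt.1 (hmin k (by omega))
  refine h1.antisymm ?_
  by_contra! h2
  rw [hk, Nat.cast_add, Nat.cast_one, add_comm, zpow_one_add, Equiv.Perm.mul_apply] at hn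
  refine absurd hn (not_lt.2 ((h.isLeast_next _).2 ⟨?_, h2⟩))
  rw [h.nextPerm_zpow_fst, hzw]
  exact w.2

variable (φ H) in
/-- The projection from the space of hitting times. -/
def proj (z : HittingTimes φ H) : X := z.1.1

/-- The flow box provides the local section `y ↦ (y, τ y)` through any given point. -/
lemma isOpenMap_proj (h : IsTopologicalSection φ H) : IsOpenMap (proj φ H) := by
  refine IsOpenMap.of_nhds_le fun z S hS ↦ ?_
  rw [Filter.mem_map] at hS
  obtain ⟨N, hN, hNS⟩ := mem_nhds_induced _ _ _ |>.1 hS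
  obtain ⟨ε, hε, τ, hc, h0, hτ⟩ := h.flowBox_at z.2
  have ht : Tendsto (fun y ↦ (y, τ y)) (𝓝 z.1.1) (𝓝 z.1) := by
    have := hc.self_of_nhds
    rw [ContinuousAt, h0] at this
    exact tendsto_id.prodMk_nhds this
  filter_upwards [ht.eventually hN, hτ] with y h1 h2
  exact hNS (show ((⟨(y, τ y), (h2.2 _ h2.1).2 rfl⟩ : HittingTimes φ H) : X × ℝ) ∈ N from h1)

/-- The space of hitting times is a covering space. -/
lemma isCoveringMap_proj (h : IsTopologicalSection φ H) : IsCoveringMap (proj φ H) := by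
  have hcont : Continuous (proj φ H) := continuous_fst.comp continuous_subtype_val
  have hsurj : Function.Surjective (proj φ H) := fun x ↦ by
    obtain ⟨t, -, ht⟩ := h.forward x
    exact ⟨⟨(x, t), ht⟩, rfl⟩
  -- The base is the quotient by the action of `ℤ` that shifts hitting times; its orbits are the
  -- fibres and it is properly discontinuous.
  have hq : IsQuotientCoveringMap (proj φ H) (Subgroup.zpowers h.nextPerm) :=
    { (h.isOpenMap_proj.isQuotientMap hcont hsurj) with
      continuous_const_smul := by
        rintro ⟨g, n, rfl⟩
        exact h.continuous_nextPerm_zpow n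
      apply_eq_iff_mem_orbit := by
        intro z w
        constructor
        · intro hzw
          rcases le_total z.1.2 w.1.2 with hle | hle
          · obtain ⟨n, hn⟩ := h.exists_nextPerm_zpow_eq_of_le hzw hle
            rw [MulAction.mem_orbit_symm]
            exact ⟨⟨_, n, rfl⟩, hn⟩
          · obtain ⟨n, hn⟩ := h.exists_nextPerm_zpow_eq_of_le (Eq.symm hzw) hle
            exact ⟨⟨_, n, rfl⟩, hn⟩
        · rintro ⟨⟨g, n, rfl⟩, rfl⟩
          exact h.nextPerm_zpow_fst n w
      disjoint := by
        intro z
        obtain ⟨ε, hε, τ, -, h0, hτ⟩ := h.flowBox_at z.2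
        -- In this neighbourhood every orbit has a single hitting time, so a shift mapping one of
        -- its points back into it is trivial.
        refine ⟨{w | (|τ w.1.1 - z.1.2| < ε ∧ ∀ t : ℝ, |t - z.1.2| < ε →
          (φ t w.1.1 ∈ H ↔ t = τ w.1.1)) ∧ |w.1.2 - z.1.2| < ε}, ?_, ?_⟩
        · refine Filter.inter_mem (hcont.continuousAt.eventually hτ) ?_
          have : Continuous fun w : HittingTimes φ H ↦ |w.1.2 - z.1.2| := by fun_prop
          exact this.continuousAt.eventually (gt_mem_nhds (by simpa using hε))
        · rintro ⟨g, n, rfl⟩ ⟨_, ⟨w, hw, rfl⟩, hw'⟩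
          have h1 := (hw.1.2 _ hw.2).1 w.2
          have h2 := (hw'.1.2 _ hw'.2).1 ((h.nextPerm ^ n) w).2
          have h3 : ((h.nextPerm ^ n) w).1.2 = ((h.nextPerm ^ (0 : ℤ)) w).1.2 := by
            rw [zpow_zero, Equiv.Perm.one_apply, h1]
            refine Eq.trans h2 (congrArg τ (h.nextPerm_zpow_fst n w))
          have := (h.strictMono_nextPerm_zpow w).injective h3
          ext1
          simp [this] }
  exact hq.isCoveringMap

/-- A periodic orbit of a flow with a section is not null-homotopic. -/
theorem not_nullhomotopic (h : IsTopologicalSection φ H) {x : X} {T : ℝ} (hT : T ≠ 0)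
    {γ : C(unitInterval, X)} (hγ : ∀ s : unitInterval, γ s = φ (s * T) x) :
    ¬ γ.HomotopicRel (ContinuousMap.const _ x) {0, 1} := by
  intro hom
  have cov := h.isCoveringMap_proj
  obtain ⟨t, -, ht⟩ := h.forward x
  have h0 : γ 0 = proj φ H ⟨(x, t), ht⟩ := by simp [hγ, proj]
  have h1 : ContinuousMap.const unitInterval x 0 = proj φ H ⟨(x, t), ht⟩ := rfl
  have hlift := cov.liftPath_apply_one_eq_of_homotopicRel hom _ h0 h1
  have hconst := cov.liftPath_const (x := x) (e := ⟨(x, t), ht⟩) rfl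
  -- The explicit lift: after flowing for time `s * T`, the hit at `t` lies at `t - s * T`. It ends
  -- at time `t - T`, whereas the constant path lifts to one ending at `t`.
  let Γ : unitInterval → HittingTimes φ H := fun s ↦ ⟨(φ (s * T) x, t - s * T), by
    simpa [← Flow.map_add] using ht⟩
  have hΓ : Γ = cov.liftPath γ ⟨(x, t), ht⟩ h0 := by
    refine (cov.eq_liftPath_iff h0).2 ⟨Continuous.subtype_mk (by fun_prop) _, ?_, ?_⟩
    · ext s; exact (hγ s).symm
    · simp [Γ]
  rw [hconst, ← hΓ] at hlift
  have := congrArg (fun z ↦ z.1.2) hlift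
  simp [Γ] at this
  exact hT this

end IsTopologicalSection

/-! ### The toric contact form -/

/-- The moment map `|z₁|² - |z₂|²` on `ℂ²`. -/
def moment (x : EuclideanSpace ℝ (Fin 4)) : ℝ := x 0 ^ 2 + x 1 ^ 2 - x 2 ^ 2 - x 3 ^ 2

/-- Multiplication by `i`, as a continuous linear map. -/
noncomputable def mulIL : EuclideanSpace ℝ (Fin 4) →L[ℝ] EuclideanSpace ℝ (Fin 4) :=
  LinearMap.toContinuousLinearMap
    { toFun := mulI
      map_add' := fun x y ↦ by
        ext i; fin_cases i <;> simp [mulI] <;> ring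
      map_smul' := fun c x ↦ by
        ext i; fin_cases i <;> simp [mulI] }

@[simp] lemma mulIL_apply (x : EuclideanSpace ℝ (Fin 4)) : mulIL x = mulI x := rfl

/-- The contact form `(1 + 3 (|z₁|² - |z₂|²)²) λ₀`, where `λ₀` is the standard contact form. -/
noncomputable def toricForm (x : EuclideanSpace ℝ (Fin 4)) :
    EuclideanSpace ℝ (Fin 4) [⋀^Fin 1]→L[ℝ] ℝ :=
  -- For a factor `f = 1 + c m²` the Reeb speed of `z₁` is `(f - (1 - m) f') / f²`, with numerator
  -- `1 - 2cm + 3cm²`. The value `c = 3` is the least positive one for which it has a real zero: it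
  -- becomes `(1 - 3m)²`.
  (1 + 3 * moment x ^ 2) •
    ContinuousAlternatingMap.ofSubsingletonLIE (0 : Fin 1) (innerSL ℝ (mulIL x))

lemma inner_eq_sum (x y : EuclideanSpace ℝ (Fin 4)) :
    ⟪x, y⟫ = x 0 * y 0 + x 1 * y 1 + x 2 * y 2 + x 3 * y 3 := by
  simp [PiLp.inner_apply, Fin.sum_univ_four, mul_comm]

lemma inner_mulI (x v : EuclideanSpace ℝ (Fin 4)) :
    ⟪mulI x, v⟫ = -x 1 * v 0 + x 0 * v 1 - x 3 * v 2 + x 2 * v 3 := by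
  simp [inner_eq_sum, mulI]; ring

lemma toricForm_apply (x v : EuclideanSpace ℝ (Fin 4)) :
    toricForm x ![v] = (1 + 3 * moment x ^ 2) * ⟪mulI x, v⟫ := by
  rfl

lemma contDiff_moment : ContDiff ℝ ∞ moment := by
  unfold moment; fun_prop

lemma contDiff_toricForm : ContDiff ℝ ∞ toricForm := by
  have := contDiff_moment
  unfold toricForm
  refine ContDiff.smul (contDiff_const.add (contDiff_const.mul (this.pow 2))) ?_
  exact (LinearIsometryEquiv.contDiff _).comp ((innerSL ℝ).contDiff.comp mulIL.contDiff)

lemma hasFDerivAt_coord (i : Fin 4) (x : EuclideanSpace ℝ (Fin 4)) :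
    HasFDerivAt (fun y : EuclideanSpace ℝ (Fin 4) ↦ y i)
      (EuclideanSpace.proj i : EuclideanSpace ℝ (Fin 4) →L[ℝ] ℝ) x :=
  (EuclideanSpace.proj i : EuclideanSpace ℝ (Fin 4) →L[ℝ] ℝ).hasFDerivAt

lemma fderiv_toricForm_apply (x u v : EuclideanSpace ℝ (Fin 4)) :
    fderiv ℝ (fun y ↦ toricForm y ![v]) x u =
      12 * moment x * (x 0 * u 0 + x 1 * u 1 - x 2 * u 2 - x 3 * u 3) * ⟪mulI x, v⟫ +
        (1 + 3 * moment x ^ 2) * ⟪mulI u, v⟫ := by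
  have h := fun i ↦ hasFDerivAt_coord i x
  have hm : HasFDerivAt moment _ x :=
    (((h 0).pow 2).add ((h 1).pow 2)).sub ((h 2).pow 2) |>.sub ((h 3).pow 2)
  have hf := ((hm.pow 2).const_mul 3).const_add 1
  have hl : HasFDerivAt (fun y ↦ ⟪mulI y, v⟫) ((innerSL ℝ v).comp mulIL) x := by
    refine ((innerSL ℝ v).comp mulIL).hasFDerivAt.congr_of_eventuallyEq
      (Eventually.of_forall fun y ↦ ?_)
    simp [real_inner_comm]
  have := hf.mul hl
  simp_rw [toricForm_apply]
  refine (congrArg (fun L ↦ L u) this.fderiv).trans ?_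
  simp [real_inner_comm]
  ring

/-- This is `d(f λ₀) = df ∧ λ₀ + f dλ₀` with `df = 6m dm` and `dλ₀(u, v) = 2⟪iu, v⟫`. -/
lemma extDeriv_toricForm (x u v : EuclideanSpace ℝ (Fin 4)) :
    extDeriv toricForm x ![u, v] =
      12 * moment x * ((x 0 * u 0 + x 1 * u 1 - x 2 * u 2 - x 3 * u 3) * ⟪mulI x, v⟫ -
        (x 0 * v 0 + x 1 * v 1 - x 2 * v 2 - x 3 * v 3) * ⟪mulI x, u⟫) +
        2 * (1 + 3 * moment x ^ 2) * ⟪mulI u, v⟫ := by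
  rw [extDeriv_apply (contDiff_toricForm.differentiable (by simp) x), Fin.sum_univ_two]
  have h0 : (0 : Fin 2).removeNth ![u, v] = ![v] := by ext i; fin_cases i; rfl
  have h1 : (1 : Fin 2).removeNth ![u, v] = ![u] := by ext i; fin_cases i; rfl
  rw [h0, h1]
  simp only [Matrix.cons_val_zero, Matrix.cons_val_one, fderiv_toricForm_apply]
  simp [inner_mulI]
  ring

lemma mem_tangentPlane_iff {x : ThreeSphere} {v : EuclideanSpace ℝ (Fin 4)} :
    v ∈ tangentPlane x ↔ (x : EuclideanSpace ℝ (Fin 4)) 0 * v 0 + x.1 1 * v 1 + x.1 2 * v 2 +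
      x.1 3 * v 3 = 0 := by
  rw [tangentPlane, Submodule.mem_orthogonal_singleton_iff_inner_right, inner_eq_sum]

lemma sum_sq_eq_one (x : ThreeSphere) :
    x.1 0 ^ 2 + x.1 1 ^ 2 + x.1 2 ^ 2 + x.1 3 ^ 2 = 1 := by
  have h : ‖(x : EuclideanSpace ℝ (Fin 4))‖ = 1 := norm_eq_of_mem_sphere x
  have := EuclideanSpace.norm_sq_eq (x : EuclideanSpace ℝ (Fin 4))
  rw [h] at this
  simp [Fin.sum_univ_four] at this
  linarith

lemma toricForm_factor_pos (x : EuclideanSpace ℝ (Fin 4)) : 0 < 1 + 3 * moment x ^ 2 := by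
  positivity

lemma isContactFormOnSphere_toricForm : IsContactFormOnSphere toricForm where
  smooth := contDiff_toricForm
  ne_zero x := by
    refine ⟨mulI x, ?_, ?_⟩
    · rw [mem_tangentPlane_iff]; simp [mulI]; ring
    · rw [toricForm_apply, inner_mulI]
      have := sum_sq_eq_one x
      have h2 := toricForm_factor_pos x
      refine mul_ne_zero h2.ne' ?_
      simp [mulI]
      nlinarith
  nondegenerate x u hu hxu hu0 := by
    rw [toricForm_apply] at hxu
    have h2 := toricForm_factor_pos x
    have hxu : ⟪mulI x.1, u⟫ = 0 := by simpa [h2.ne'] using hxu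
    have hv : ⟪mulI x.1, mulI u⟫ = 0 := by
      rw [mem_tangentPlane_iff] at hu
      rw [inner_mulI]
      simp [mulI]
      linarith
    -- The contact plane is invariant under `i`, and on it `dα(u, iu)` is a positive multiple of
    -- `|u|²`.
    refine ⟨mulI u, ?_, ?_, ?_⟩
    · rw [inner_mulI] at hxu
      rw [mem_tangentPlane_iff]
      simp [mulI]
      linarith
    · rw [toricForm_apply, hv, mul_zero]
    · rw [extDeriv_toricForm, hxu, hv]
      have : ⟪mulI u, mulI u⟫ = ⟪u, u⟫ := by
        rw [inner_mulI, inner_eq_sum]; simp [mulI]; ring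
      rw [this]
      have := real_inner_self_pos.2 hu0
      have h4 := toricForm_factor_pos x
      simp only [mul_zero, sub_zero, zero_add]
      positivity

lemma ker_toricForm (x : ThreeSphere) :
    {v | v ∈ tangentPlane x ∧ toricForm x ![v] = 0} = standardContactPlane x := by
  ext v
  have h2 := toricForm_factor_pos x
  simp [standardContactPlane, toricForm_apply, h2.ne']

/-! ### The Reeb vector field and its flow -/

/-- The angular speed of the Reeb flow on the level `m` of the moment map, in the first
coordinate. The angular speed in the second coordinate is `angularSpeed (-m)`. -/
noncomputable def angularSpeed (m : ℝ) : ℝ := (1 - 3 * m) ^ 2 / (1 + 3 * m ^ 2) ^ 2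

/-- Rotation of `ℝ⁴ = ℂ²` with angle `a` in the first and `b` in the second coordinate. -/
noncomputable def rot (a b : ℝ) (x : EuclideanSpace ℝ (Fin 4)) : EuclideanSpace ℝ (Fin 4) :=
  !₂[Real.cos a * x 0 - Real.sin a * x 1, Real.sin a * x 0 + Real.cos a * x 1,
    Real.cos b * x 2 - Real.sin b * x 3, Real.sin b * x 2 + Real.cos b * x 3]

/-- The generator of the rotations of `ℝ⁴ = ℂ²` with speeds `a` and `b`. -/
noncomputable def rotGen (a b : ℝ) (x : EuclideanSpace ℝ (Fin 4)) : EuclideanSpace ℝ (Fin 4) :=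
  !₂[-(a * x 1), a * x 0, -(b * x 3), b * x 2]

/-- The Reeb vector field of `toricForm`, as a vector field on `ℝ⁴`. -/
noncomputable def toricReeb (x : EuclideanSpace ℝ (Fin 4)) : EuclideanSpace ℝ (Fin 4) :=
  rotGen (angularSpeed (moment x)) (angularSpeed (-moment x)) x

/-- The flow of `toricReeb` on `ℝ⁴`. -/
noncomputable def toricMap (t : ℝ) (x : EuclideanSpace ℝ (Fin 4)) : EuclideanSpace ℝ (Fin 4) :=
  rot (angularSpeed (moment x) * t) (angularSpeed (-moment x) * t) x

/-- On the sphere `|z₁|² = (1 + m)/2` and `|z₂|² = (1 - m)/2`, and for tangent `v` the pairings of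
`v` with the two coordinates of `x` are opposite. Both conditions thus become rational identities in
`m`. -/
lemma isReebVectorField_toricReeb :
    IsReebVectorField toricForm (fun x : ThreeSphere ↦ toricReeb x) where
  tangent x := by
    rw [mem_tangentPlane_iff]
    simp [toricReeb, rotGen]
    ring
  normalized x := by
    rw [toricForm_apply, inner_mulI]
    have h := sum_sq_eq_one x
    have h4 := toricForm_factor_pos x
    have hm : moment x.1 = x.1 0 ^ 2 + x.1 1 ^ 2 - x.1 2 ^ 2 - x.1 3 ^ 2 := rfl
    have e1 : x.1 0 ^ 2 + x.1 1 ^ 2 = (1 + moment x.1) / 2 := by linarith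
    have e2 : x.1 2 ^ 2 + x.1 3 ^ 2 = (1 - moment x.1) / 2 := by linarith
    have e : -x.1 1 * toricReeb x 0 + x.1 0 * toricReeb x 1 - x.1 3 * toricReeb x 2 +
        x.1 2 * toricReeb x 3 = angularSpeed (moment x) * (x.1 0 ^ 2 + x.1 1 ^ 2) +
        angularSpeed (-moment x) * (x.1 2 ^ 2 + x.1 3 ^ 2) := by
      simp [toricReeb, rotGen]; ring
    rw [e, e1, e2]
    generalize moment x.1 = m at *
    simp only [angularSpeed, even_two, Even.neg_pow]
    field_simp
    ring
  kernel x v hv := by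
    rw [mem_tangentPlane_iff] at hv
    rw [extDeriv_toricForm]
    have h := sum_sq_eq_one x
    have h4 := toricForm_factor_pos x
    have hm : moment x.1 = x.1 0 ^ 2 + x.1 1 ^ 2 - x.1 2 ^ 2 - x.1 3 ^ 2 := rfl
    have e1 : x.1 0 ^ 2 + x.1 1 ^ 2 = (1 + moment x.1) / 2 := by linarith
    have e2 : x.1 2 ^ 2 + x.1 3 ^ 2 = (1 - moment x.1) / 2 := by linarith
    have e : ⟪mulI x.1, toricReeb x⟫ = angularSpeed (moment x) * (x.1 0 ^ 2 + x.1 1 ^ 2) +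
        angularSpeed (-moment x) * (x.1 2 ^ 2 + x.1 3 ^ 2) := by
      rw [inner_mulI]; simp [toricReeb, rotGen]; ring
    have e0 : x.1 0 * toricReeb x 0 + x.1 1 * toricReeb x 1 - x.1 2 * toricReeb x 2 -
        x.1 3 * toricReeb x 3 = 0 := by
      simp [toricReeb, rotGen]; ring
    have e3 : ⟪mulI (toricReeb x), v⟫ = -(angularSpeed (moment x) * (x.1 0 * v 0 + x.1 1 * v 1)) -
        angularSpeed (-moment x) * (x.1 2 * v 2 + x.1 3 * v 3) := by
      rw [inner_mulI]; simp [toricReeb, rotGen]; ring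
    rw [e0, e, e1, e2, e3]
    have e5 : x.1 2 * v 2 + x.1 3 * v 3 = -(x.1 0 * v 0 + x.1 1 * v 1) := by linarith
    have e6 : x.1 0 * v 0 + x.1 1 * v 1 - x.1 2 * v 2 - x.1 3 * v 3 =
      2 * (x.1 0 * v 0 + x.1 1 * v 1) := by linarith
    rw [e5, e6]
    generalize x.1 0 * v 0 + x.1 1 * v 1 = k at *
    generalize moment x.1 = m at *
    simp only [angularSpeed, even_two, Even.neg_pow]
    field_simp
    ring

lemma moment_rot (a b : ℝ) (x : EuclideanSpace ℝ (Fin 4)) : moment (rot a b x) = moment x := by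
  simp [moment, rot]
  linear_combination (x 0 ^ 2 + x 1 ^ 2) * Real.sin_sq_add_cos_sq a -
    (x 2 ^ 2 + x 3 ^ 2) * Real.sin_sq_add_cos_sq b

lemma norm_rot (a b : ℝ) (x : EuclideanSpace ℝ (Fin 4)) : ‖rot a b x‖ = ‖x‖ := by
  rw [EuclideanSpace.norm_eq, EuclideanSpace.norm_eq]
  congr 1
  simp [Fin.sum_univ_four, rot]
  linear_combination (x 0 ^ 2 + x 1 ^ 2) * Real.sin_sq_add_cos_sq a +
    (x 2 ^ 2 + x 3 ^ 2) * Real.sin_sq_add_cos_sq b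

lemma rot_rot (a b a' b' : ℝ) (x : EuclideanSpace ℝ (Fin 4)) :
    rot a b (rot a' b' x) = rot (a + a') (b + b') x := by
  ext i
  fin_cases i <;> simp [rot, Real.cos_add, Real.sin_add] <;> ring

lemma rot_zero (x : EuclideanSpace ℝ (Fin 4)) : rot 0 0 x = x := by
  ext i
  fin_cases i <;> simp [rot]

lemma moment_toricMap (t : ℝ) (x : EuclideanSpace ℝ (Fin 4)) :
    moment (toricMap t x) = moment x := moment_rot _ _ x

lemma contDiff_angularSpeed : ContDiff ℝ ∞ angularSpeed := by
  unfold angularSpeed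
  exact ContDiff.div (by fun_prop) (by fun_prop) fun m ↦ by positivity

lemma contDiff_rot : ContDiff ℝ ∞ fun p : ℝ × ℝ × EuclideanSpace ℝ (Fin 4) ↦
    rot p.1 p.2.1 p.2.2 := by
  rw [contDiff_euclidean]
  have h (j : Fin 4) : ContDiff ℝ ∞ fun p : ℝ × ℝ × EuclideanSpace ℝ (Fin 4) ↦ p.2.2 j :=
    (EuclideanSpace.proj j : EuclideanSpace ℝ (Fin 4) →L[ℝ] ℝ).contDiff.comp
      (contDiff_snd.comp contDiff_snd)
  have h1 : ContDiff ℝ ∞ fun p : ℝ × ℝ × EuclideanSpace ℝ (Fin 4) ↦ p.1 := contDiff_fst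
  have h2 : ContDiff ℝ ∞ fun p : ℝ × ℝ × EuclideanSpace ℝ (Fin 4) ↦ p.2.1 :=
    contDiff_fst.comp contDiff_snd
  intro i
  fin_cases i
  · exact (h1.cos.mul (h 0)).sub (h1.sin.mul (h 1))
  · exact (h1.sin.mul (h 0)).add (h1.cos.mul (h 1))
  · exact (h2.cos.mul (h 2)).sub (h2.sin.mul (h 3))
  · exact (h2.sin.mul (h 2)).add (h2.cos.mul (h 3))

lemma contDiff_toricMap : ContDiff ℝ ∞ fun p : ℝ × EuclideanSpace ℝ (Fin 4) ↦
    toricMap p.1 p.2 := by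
  have h1 : ContDiff ℝ ∞ fun p : ℝ × EuclideanSpace ℝ (Fin 4) ↦ moment p.2 :=
    contDiff_moment.comp contDiff_snd
  have h2 : ContDiff ℝ ∞ fun p : ℝ × EuclideanSpace ℝ (Fin 4) ↦ angularSpeed (moment p.2) * p.1 :=
    (contDiff_angularSpeed.comp h1).mul contDiff_fst
  have h3 : ContDiff ℝ ∞ fun p : ℝ × EuclideanSpace ℝ (Fin 4) ↦ angularSpeed (-moment p.2) * p.1 :=
    (contDiff_angularSpeed.comp h1.neg).mul contDiff_fst
  have h4 := h2.prodMk (h3.prodMk contDiff_snd)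
  have := contDiff_rot.comp h4
  exact this

/-- The Reeb flow of `toricForm`. -/
noncomputable def toricFlow : Flow ℝ ThreeSphere where
  toFun t x := ⟨toricMap t x, by
    rw [mem_sphere_zero_iff_norm, toricMap, norm_rot]; exact norm_eq_of_mem_sphere x⟩
  cont' := Continuous.subtype_mk (contDiff_toricMap.continuous.comp
    (continuous_fst.prodMk (continuous_subtype_val.comp continuous_snd))) _
  map_add' s t x := Subtype.ext <| by
    change toricMap (s + t) x = toricMap s (toricMap t x)
    conv_rhs => rw [toricMap, moment_toricMap, toricMap, rot_rot]
    rw [toricMap, mul_add, mul_add]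
  map_zero' x := Subtype.ext <| by
    simp [toricMap, rot_zero]

@[simp] lemma coe_toricFlow (t : ℝ) (x : ThreeSphere) :
    (toricFlow t x : EuclideanSpace ℝ (Fin 4)) = toricMap t x := rfl

lemma hasDerivAt_rot (a b t : ℝ) (x : EuclideanSpace ℝ (Fin 4)) :
    HasDerivAt (fun s ↦ rot (a * s) (b * s) x) (rotGen a b (rot (a * t) (b * t) x)) t := by
  have h (c : ℝ) : HasDerivAt (fun s ↦ Real.cos (c * s)) (-Real.sin (c * t) * c) t := by
    simpa using! (Real.hasDerivAt_cos (c * t)).comp t ((hasDerivAt_id t).const_mul c)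
  have h' (c : ℝ) : HasDerivAt (fun s ↦ Real.sin (c * s)) (Real.cos (c * t) * c) t := by
    simpa using! (Real.hasDerivAt_sin (c * t)).comp t ((hasDerivAt_id t).const_mul c)
  refine (EuclideanSpace.equiv (Fin 4) ℝ).symm.hasFDerivAt.comp_hasDerivAt t
    (f := fun s ↦ (rot (a * s) (b * s) x).ofLp) (f' := (rotGen a b (rot (a * t) (b * t) x)).ofLp)
    (hasDerivAt_pi.2 ?_)
  intro i
  fin_cases i
  · convert! ((h a).mul_const (x 0)).sub ((h' a).mul_const (x 1)) using 1
    simp [rotGen, rot]; ring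
  · convert! ((h' a).mul_const (x 0)).add ((h a).mul_const (x 1)) using 1
    simp [rotGen, rot]; ring
  · convert! ((h b).mul_const (x 2)).sub ((h' b).mul_const (x 3)) using 1
    simp [rotGen, rot]; ring
  · convert! ((h' b).mul_const (x 2)).add ((h b).mul_const (x 3)) using 1
    simp [rotGen, rot]; ring

lemma isFlowOf_toricFlow : IsFlowOf (fun x : ThreeSphere ↦ toricReeb x) toricFlow := by
  intro x t
  have := hasDerivAt_rot (angularSpeed (moment x)) (angularSpeed (-moment x)) t x
  simp only [toricReeb, coe_toricFlow, moment_toricMap]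
  exact this

lemma toricMap_zero (x : EuclideanSpace ℝ (Fin 4)) : toricMap 0 x = x := by
  simp [toricMap, rot_zero]

lemma hasDerivAt_toricMap_zero (x : EuclideanSpace ℝ (Fin 4)) :
    HasDerivAt (fun t ↦ toricMap t x) (toricReeb x) 0 := by
  have := hasDerivAt_rot (angularSpeed (moment x)) (angularSpeed (-moment x)) 0 x
  rw [mul_zero, mul_zero, rot_zero] at this
  exact this

lemma inner_toricReeb (x : EuclideanSpace ℝ (Fin 4)) : ⟪x, toricReeb x⟫ = 0 := by
  rw [inner_eq_sum]
  simp [toricReeb, rotGen]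
  ring

attribute [irreducible] toricMap toricReeb

/-! ### Differentials of immersions and expressions in charts -/

section Immersion

variable {E H E' G M N : Type*} [NormedAddCommGroup E] [NormedSpace ℝ E] [NormedAddCommGroup E']
  [NormedSpace ℝ E'] [TopologicalSpace H] [TopologicalSpace G] [TopologicalSpace M]
  [TopologicalSpace N] [ChartedSpace H M] [ChartedSpace G N] {I : ModelWithCorners ℝ E H}
  {J : ModelWithCorners ℝ E' G} {n : WithTop ℕ∞}

lemma mdifferentiable_of_mem_maximalAtlas [IsManifold I 1 M] {e : OpenPartialHomeomorph M H}
    (he : e ∈ IsManifold.maximalAtlas I 1 M) : e.MDifferentiable I I :=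
  ⟨fun _ hx ↦ (mdifferentiableAt_of_mem_maximalAtlas he hx).mdifferentiableWithinAt,
    fun _ hx ↦ (mdifferentiableAt_symm_of_mem_maximalAtlas he hx).mdifferentiableWithinAt⟩

/-- The differential of an immersion is injective. -/
lemma Manifold.IsImmersionAt.mfderiv_injective [IsManifold I 1 M] [IsManifold J 1 N] {f : M → N}
    {x : M} (h : IsImmersionAt I J n f x) (hn : 1 ≤ n) : Function.Injective (mfderiv I J f x) := by
  have hd := mdifferentiable_of_mem_maximalAtlas
    (IsManifold.maximalAtlas_subset_of_le hn h.domChart_mem_maximalAtlas)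
  have hc := mdifferentiable_of_mem_maximalAtlas
    (IsManifold.maximalAtlas_subset_of_le hn h.codChart_mem_maximalAtlas)
  have hf : MDifferentiableAt I J f x := h.contMDiffAt.mdifferentiableAt (by positivity)
  have hcx := (hc.mdifferentiableAt h.mem_codChart_source)
  have hdx := (hd.mdifferentiableAt h.mem_domChart_source)
  -- In charts adapted to the immersion, `f` is the linear injection `u ↦ (u, 0)`.
  have key : (h.codChart.extend J) ∘ f =ᶠ[𝓝 x]
      (h.equiv ∘ (·, (0 : h.complement))) ∘ (h.domChart.extend I) := by
    filter_upwards [h.domChart.open_source.mem_nhds h.mem_domChart_source] with q hq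
    have := h.writtenInCharts ((h.domChart.extend I).map_source (by simpa using hq))
    simpa [hq] using this
  let T : E →L[ℝ] E' := (h.equiv : (E × h.complement) →L[ℝ] E').comp
    (ContinuousLinearMap.inl ℝ E h.complement)
  have hT : Function.Injective T :=
    h.equiv.injective.comp fun a b hab ↦ (Prod.mk.inj hab).1
  have hdL : HasMFDerivAt I 𝓘(ℝ, E) (h.domChart.extend I) x (mfderiv I I h.domChart x) :=
    (I.hasMFDerivAt (x := h.domChart x)).comp x hdx.hasMFDerivAt
  have hcL : HasMFDerivAt J 𝓘(ℝ, E') (h.codChart.extend J) (f x)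
      (mfderiv J J h.codChart (f x)) :=
    (J.hasMFDerivAt (x := h.codChart (f x))).comp (f x) hcx.hasMFDerivAt
  have h1 := hcL.comp x hf.hasMFDerivAt
  have h2 : HasMFDerivAt I 𝓘(ℝ, E') ((h.equiv ∘ (·, (0 : h.complement))) ∘ h.domChart.extend I) x
      (T.comp (mfderiv I I h.domChart x)) :=
    (T.hasMFDerivAt (x := h.domChart.extend I x)).comp x hdL
  have h3 := hasMFDerivAt_unique h1 (h2.congr_of_eventuallyEq key)
  intro v w hvw
  refine hd.mfderiv_injective h.mem_domChart_source (hT ?_)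
  have hv := congrArg (fun L ↦ L v) h3
  have hw := congrArg (fun L ↦ L w) h3
  refine hv.symm.trans (Eq.trans ?_ hw)
  exact congrArg (mfderiv J J h.codChart (f x)) hvw

end Immersion

section Charts

variable {M : Type*} [TopologicalSpace M] [ChartedSpace (EuclideanHalfSpace 2) M]
  {E : Type*} [NormedAddCommGroup E] [NormedSpace ℝ E]

lemma contDiffAt_comp_extChartAt_symm [IsManifold (𝓡∂ 2) ∞ M] {g : M → E} {p : M}
    (hg : ContMDiffAt (𝓡∂ 2) 𝓘(ℝ, E) ∞ g p) (hp : (𝓡∂ 2).IsInteriorPoint p) :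
    ContDiffAt ℝ ∞ (g ∘ (extChartAt (𝓡∂ 2) p).symm) (extChartAt (𝓡∂ 2) p p) := by
  have := (contMDiffAt_iff.1 hg).2
  have h2 := this.contDiffAt (range_mem_nhds_isInteriorPoint hp)
  exact h2

lemma mfderiv_eq_fderiv_comp_extChartAt_symm {g : M → E} {p : M}
    (hg : MDifferentiableAt (𝓡∂ 2) 𝓘(ℝ, E) g p) (hp : (𝓡∂ 2).IsInteriorPoint p) :
    mfderiv (𝓡∂ 2) 𝓘(ℝ, E) g p =
      fderiv ℝ (g ∘ (extChartAt (𝓡∂ 2) p).symm) (extChartAt (𝓡∂ 2) p p) := by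
  rw [hg.mfderiv]
  exact fderivWithin_of_mem_nhds (range_mem_nhds_isInteriorPoint hp)

end Charts

/-! ### Flow boxes at interior points of a transverse surface -/

section FlowBox


/-- The map `(u, t, r) ↦ (1 + r) φ_t(σ(u))` is a local diffeomorphism if `σ` parametrizes a surface
in the three-sphere transverse to the Reeb vector field. -/
lemma exists_hasStrictFDerivAt_equiv {σ : EuclideanSpace ℝ (Fin 2) → EuclideanSpace ℝ (Fin 4)}
    {u₀ : EuclideanSpace ℝ (Fin 2)} (hσ : ContDiffAt ℝ ∞ σ u₀) (hnorm : ∀ᶠ u in 𝓝 u₀, ‖σ u‖ = 1)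
    (hinj : Function.Injective (fderiv ℝ σ u₀)) (htr : ∀ v, fderiv ℝ σ u₀ v ≠ toricReeb (σ u₀)) :
    ∃ L : (EuclideanSpace ℝ (Fin 2) × ℝ × ℝ) ≃L[ℝ] EuclideanSpace ℝ (Fin 4),
      HasStrictFDerivAt (fun q : EuclideanSpace ℝ (Fin 2) × ℝ × ℝ ↦
        (1 + q.2.2) • toricMap q.2.1 (σ q.1))
        (L : (EuclideanSpace ℝ (Fin 2) × ℝ × ℝ) →L[ℝ] EuclideanSpace ℝ (Fin 4)) (u₀, 0, 0) := by
  -- The radial variable `r` thickens the sphere, so that the inverse function theorem applies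
  -- between spaces of dimension four.
  set Ψ := fun q : EuclideanSpace ℝ (Fin 2) × ℝ × ℝ ↦ (1 + q.2.2) • toricMap q.2.1 (σ q.1)
  have hσd : DifferentiableAt ℝ σ u₀ := hσ.differentiableAt (by simp)
  have hΨ : ContDiffAt ℝ ∞ Ψ (u₀, 0, 0) := by
    have h0 : ContDiffAt ℝ ∞ (fun q : EuclideanSpace ℝ (Fin 2) × ℝ × ℝ ↦ 1 + q.2.2)
        (u₀, 0, 0) := contDiffAt_const.add (contDiff_snd.comp contDiff_snd).contDiffAt
    have h1 : ContDiffAt ℝ ∞ (fun q : EuclideanSpace ℝ (Fin 2) × ℝ × ℝ ↦ (q.2.1, σ q.1))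
        (u₀, 0, 0) := by
      refine (contDiff_fst.comp contDiff_snd).contDiffAt.prodMk ?_
      exact ContDiffAt.comp (u₀, (0 : ℝ), (0 : ℝ)) (f := Prod.fst) hσ contDiffAt_fst
    have h2 : ContDiffAt ℝ ∞ (fun q : EuclideanSpace ℝ (Fin 2) × ℝ × ℝ ↦ toricMap q.2.1 (σ q.1))
        (u₀, 0, 0) :=
      ContDiffAt.comp (u₀, (0 : ℝ), (0 : ℝ)) (g := fun p : ℝ × _ ↦ toricMap p.1 p.2)
        contDiff_toricMap.contDiffAt h1
    exact h0.smul h2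
  have hs := hΨ.hasStrictFDerivAt (by simp)
  set D := fderiv ℝ Ψ (u₀, 0, 0) with hD
  have hd : HasFDerivAt Ψ D (u₀, 0, 0) := hs.hasFDerivAt
  have D1 (v) : D (v, 0, 0) = fderiv ℝ σ u₀ v := by
    have h1 : HasFDerivAt (fun u : EuclideanSpace ℝ (Fin 2) ↦ (u, (0 : ℝ), (0 : ℝ)))
        (ContinuousLinearMap.inl ℝ (EuclideanSpace ℝ (Fin 2)) (ℝ × ℝ)) u₀ :=
      (ContinuousLinearMap.inl ℝ (EuclideanSpace ℝ (Fin 2)) (ℝ × ℝ)).hasFDerivAt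
    have h2 := HasFDerivAt.comp u₀ hd h1
    have h3 : Ψ ∘ (fun u : EuclideanSpace ℝ (Fin 2) ↦ (u, (0 : ℝ), (0 : ℝ))) = σ := by
      ext u; simp [Ψ, toricMap_zero]
    rw [h3] at h2
    rw [h2.fderiv]
    rfl
  have D2 : D (0, 1, 0) = toricReeb (σ u₀) := by
    have h1 : HasDerivAt (fun t : ℝ ↦ (u₀, t, (0 : ℝ))) (0, 1, 0) 0 :=
      (hasDerivAt_const _ _).prodMk ((hasDerivAt_id _).prodMk (hasDerivAt_const _ _))
    have h2 := HasFDerivAt.comp_hasDerivAt (0 : ℝ) hd h1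
    have h3 : Ψ ∘ (fun t : ℝ ↦ (u₀, t, (0 : ℝ))) = fun t ↦ toricMap t (σ u₀) := by
      ext u; simp [Ψ]
    rw [h3] at h2
    exact h2.unique (hasDerivAt_toricMap_zero _)
  have D3 : D (0, 0, 1) = σ u₀ := by
    have h1 : HasDerivAt (fun t : ℝ ↦ (u₀, (0 : ℝ), t)) (0, 0, 1) 0 :=
      (hasDerivAt_const _ _).prodMk ((hasDerivAt_const _ _).prodMk (hasDerivAt_id _))
    have h2 := HasFDerivAt.comp_hasDerivAt (0 : ℝ) hd h1
    have h3 : Ψ ∘ (fun t : ℝ ↦ (u₀, (0 : ℝ), t)) = fun t ↦ (1 + t) • σ u₀ := by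
      ext u; simp [Ψ, toricMap_zero]
    rw [h3] at h2
    have h4 : HasDerivAt (fun t : ℝ ↦ (1 + t) • σ u₀) ((1 : ℝ) • σ u₀) 0 :=
      ((hasDerivAt_id (0 : ℝ)).const_add 1).smul_const _
    rw [one_smul] at h4
    exact h2.unique h4
  have hDapp (v) (t r : ℝ) : D (v, t, r) =
      fderiv ℝ σ u₀ v + t • toricReeb (σ u₀) + r • σ u₀ := by
    rw [← D1, ← D2, ← D3, ← map_smul, ← map_smul, ← map_add, ← map_add]
    simp
  have hperp (v) : ⟪σ u₀, fderiv ℝ σ u₀ v⟫ = 0 := by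
    have h1 : HasFDerivAt (fun u ↦ ‖σ u‖ ^ 2) _ u₀ := hσd.hasFDerivAt.norm_sq
    have h2 : HasFDerivAt (fun u ↦ ‖σ u‖ ^ 2) (0 : EuclideanSpace ℝ (Fin 2) →L[ℝ] ℝ) u₀ :=
      (hasFDerivAt_const (1 : ℝ) u₀).congr_of_eventuallyEq (hnorm.mono fun u hu ↦ by simp [hu])
    have := congrArg (fun L ↦ L v) (h1.unique h2)
    simpa using this
  have hσ1 : ⟪σ u₀, σ u₀⟫ = 1 := by
    rw [real_inner_self_eq_norm_sq, hnorm.self_of_nhds]; norm_num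
  -- Pairing with `σ u₀`, which is orthogonal to the other two terms, removes `r`; transversality
  -- removes `t`; injectivity of `dσ` removes `v`.
  have hDinj : Function.Injective D := by
    rw [injective_iff_map_eq_zero]
    rintro ⟨v, t, r⟩ h0
    rw [hDapp] at h0
    have hr : r = 0 := by
      have := congrArg (fun w ↦ ⟪σ u₀, w⟫) h0
      simpa [inner_add_right, inner_smul_right, hperp, inner_toricReeb, hnorm.self_of_nhds]
        using this
    rw [hr, zero_smul, add_zero] at h0
    have ht : t = 0 := by
      by_contra ht
      refine htr (-(t⁻¹ • v)) ?_
      rw [map_neg, map_smul, eq_neg_of_add_eq_zero_left h0, smul_neg, smul_smul,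
        inv_mul_cancel₀ ht, one_smul, neg_neg]
    rw [ht, zero_smul, add_zero] at h0
    have hv : v = 0 := hinj (by rw [h0, map_zero])
    rw [hv, ht, hr]
    rfl
  refine ⟨(LinearMap.linearEquivOfInjective (D : _ →ₗ[ℝ] _) hDinj ?_).toContinuousLinearEquiv, ?_⟩
  · simp
  · exact hs

lemma contMDiff_coe_threeSphere : ContMDiff (𝓡 3) 𝓘(ℝ, EuclideanSpace ℝ (Fin 4)) ∞
    ((↑) : ThreeSphere → EuclideanSpace ℝ (Fin 4)) :=
  have := Fact.mk (@finrank_euclideanSpace_fin ℝ _ 4)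
  contMDiff_coe_sphere

lemma injective_mfderiv_coe_threeSphere (x : ThreeSphere) :
    Function.Injective (mfderiv (𝓡 3) 𝓘(ℝ, EuclideanSpace ℝ (Fin 4))
      ((↑) : ThreeSphere → EuclideanSpace ℝ (Fin 4)) x) := by
  have := Fact.mk (@finrank_euclideanSpace_fin ℝ _ 4)
  convert! injective_mvfderiv_subtypeVal_sphere (n := 3) x

variable {M : Type} [TopologicalSpace M] [ChartedSpace (EuclideanHalfSpace 2) M]
  [IsManifold (𝓡∂ 2) ∞ M] {f : M → ThreeSphere}

lemma mfderiv_coe_injective (hf : IsSmoothEmbedding (𝓡∂ 2) (𝓡 3) ∞ f) (p : M) :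
    Function.Injective (mfderiv (𝓡∂ 2) 𝓘(ℝ, EuclideanSpace ℝ (Fin 4))
      (fun q ↦ (f q : EuclideanSpace ℝ (Fin 4))) p) := by
  have h1 := (hf.isImmersion.isImmersionAt p).mfderiv_injective (by simp)
  have h2 : MDifferentiableAt (𝓡∂ 2) (𝓡 3) f p := hf.contMDiff.mdifferentiableAt (by simp)
  have h3 : MDifferentiableAt (𝓡 3) 𝓘(ℝ, EuclideanSpace ℝ (Fin 4))
      ((↑) : ThreeSphere → EuclideanSpace ℝ (Fin 4)) (f p) :=
    contMDiff_coe_threeSphere.mdifferentiableAt (by simp)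
  have h4 := mfderiv_comp p h3 h2
  change Function.Injective (mfderiv (𝓡∂ 2) 𝓘(ℝ, EuclideanSpace ℝ (Fin 4))
      (((↑) : ThreeSphere → EuclideanSpace ℝ (Fin 4)) ∘ f) p)
  rw [h4]
  exact (injective_mfderiv_coe_threeSphere (f p)).comp h1

/-- The inverse function theorem gives flow coordinates near `f p`, hence a hitting time. That `f`
is a topological embedding excludes hits on other sheets: points of the surface near `f p` come from
points of `M` near `p`. -/
lemma exists_flowBox (hf : IsSmoothEmbedding (𝓡∂ 2) (𝓡 3) ∞ f) {p : M}
    (hp : p ∈ (𝓡∂ 2).interior M)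
    (htr : ∀ v : TangentSpace (𝓡∂ 2) p, mfderiv (𝓡∂ 2) 𝓘(ℝ, EuclideanSpace ℝ (Fin 4))
      (fun q ↦ (f q : EuclideanSpace ℝ (Fin 4))) p v ≠ toricReeb (f p)) :
    ∃ ε > 0, ∃ τ : ThreeSphere → ℝ, (∀ᶠ y in 𝓝 (f p), ContinuousAt τ y) ∧ τ (f p) = 0 ∧
      ∀ᶠ y in 𝓝 (f p), |τ y| < ε ∧ ∀ t : ℝ, |t| < ε →
        (toricFlow t y ∈ f '' (𝓡∂ 2).interior M ↔ t = τ y) := by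
  set ψ := extChartAt (𝓡∂ 2) p with hψ
  set u₀ := ψ p with hu₀
  set g : M → EuclideanSpace ℝ (Fin 4) := fun q ↦ (f q : EuclideanSpace ℝ (Fin 4)) with hg
  have hgs : ContMDiff (𝓡∂ 2) 𝓘(ℝ, EuclideanSpace ℝ (Fin 4)) ∞ g :=
    contMDiff_coe_threeSphere.comp hf.contMDiff
  set σ := g ∘ ψ.symm with hσ
  have hσ0 : σ u₀ = f p := by
    rw [hσ, Function.comp_apply, ψ.left_inv (mem_extChartAt_source p)]
  have hinj := mfderiv_coe_injective hf p
  rw [mfderiv_eq_fderiv_comp_extChartAt_symm (hgs.mdifferentiableAt (by simp)) hp] at hinj htr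
  obtain ⟨L, hL⟩ := exists_hasStrictFDerivAt_equiv (σ := σ) (u₀ := u₀)
    (contDiffAt_comp_extChartAt_symm hgs.contMDiffAt hp)
    (Eventually.of_forall fun u ↦ norm_eq_of_mem_sphere _) hinj (by rw [hσ0]; exact htr)
  set e := hL.toOpenPartialHomeomorph with he
  have he_coe : ∀ q, e q = (1 + q.2.2) • toricMap q.2.1 (σ q.1) := fun q ↦ rfl
  have hmem : (u₀, (0 : ℝ), (0 : ℝ)) ∈ e.source := hL.mem_toOpenPartialHomeomorph_source
  have he0 : e (u₀, 0, 0) = f p := by rw [he_coe]; simp [toricMap_zero, hσ0]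
  have hes : e.symm (f p) = (u₀, 0, 0) := by rw [← he0, e.left_inv hmem]
  have hmemt : (f p : EuclideanSpace ℝ (Fin 4)) ∈ e.target := he0 ▸ e.map_source hmem
  -- A point `φ_t(σ u)` reaches the surface at time `-t`.
  set τ : ThreeSphere → ℝ := fun y ↦ -(e.symm y).2.1 with hτ
  have hval : Continuous ((↑) : ThreeSphere → EuclideanSpace ℝ (Fin 4)) := continuous_subtype_val
  have htarget : ∀ᶠ y : ThreeSphere in 𝓝 (f p), (y : EuclideanSpace ℝ (Fin 4)) ∈ e.target :=
    hval.continuousAt.eventually (e.open_target.mem_nhds hmemt)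
  -- a box in the source
  obtain ⟨A, hA, B, hB, hAB⟩ := mem_nhds_prod_iff.1 (e.open_source.mem_nhds hmem)
  obtain ⟨ε₀, hε₀, hεB⟩ := Metric.mem_nhds_iff.1 hB
  -- points of the surface close to `f p`
  have hnear : ∀ᶠ y in 𝓝 (f p), ∀ q, f q = y → q ∈ ψ.source ∧ ψ q ∈ A := by
    have : {q | q ∈ ψ.source ∧ ψ q ∈ A} ∈ 𝓝 p :=
      Filter.inter_mem (extChartAt_source_mem_nhds p) ((continuousAt_extChartAt p).eventually hA)
    rw [hf.isEmbedding.nhds_eq_comap] at this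
    obtain ⟨O, hO, hOs⟩ := this
    filter_upwards [hO] with y hy q hq
    exact hOs (show f q ∈ O by rwa [hq])
  obtain ⟨V, hV, T, hT, hVT⟩ : ∃ V ∈ 𝓝 (f p), ∃ T ∈ 𝓝 (0 : ℝ), ∀ y ∈ V, ∀ t ∈ T,
      ∀ q, f q = toricFlow t y → q ∈ ψ.source ∧ ψ q ∈ A := by
    have hc : Continuous fun q : ThreeSphere × ℝ ↦ toricFlow q.2 q.1 :=
      toricFlow.continuous continuous_snd continuous_fst
    have := (hc.tendsto (f p, 0)).eventually (by simpa using hnear)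
    obtain ⟨V, hV, T, hT, hVT⟩ := mem_nhds_prod_iff.1 this
    exact ⟨V, hV, T, hT, fun y hy t ht ↦ hVT (mk_mem_prod hy ht)⟩
  obtain ⟨ε₁, hε₁, hεT⟩ := Metric.mem_nhds_iff.1 hT
  have hcsymm : ContinuousAt (fun y : ThreeSphere ↦ e.symm y) (f p) :=
    ContinuousAt.comp (f := ((↑) : ThreeSphere → EuclideanSpace ℝ (Fin 4)))
      (e.continuousAt_symm hmemt) hval.continuousAt
  have hsymm : ∀ᶠ y : ThreeSphere in 𝓝 (f p), (e.symm y).1 ∈ interior ψ.target ∧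
      |(e.symm y).2.1| < min ε₀ ε₁ ∧ -1 < (e.symm y).2.2 := by
    have h1 : ∀ᶠ q : EuclideanSpace ℝ (Fin 2) × ℝ × ℝ in 𝓝 (u₀, 0, 0),
        q.1 ∈ interior ψ.target ∧ |q.2.1| < min ε₀ ε₁ ∧ -1 < q.2.2 := by
      have hu : u₀ ∈ interior ψ.target :=
        ((𝓡∂ 2).isInteriorPoint_iff_of_mem_atlas (n := ∞) (by simp) (chart_mem_atlas _ p)
          (mem_chart_source _ p)).1 hp
      refine (continuous_fst.continuousAt.eventually (isOpen_interior.mem_nhds hu)).and (.and ?_ ?_)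
      · have : Continuous fun q : EuclideanSpace ℝ (Fin 2) × ℝ × ℝ ↦ |q.2.1| := by fun_prop
        exact this.continuousAt.eventually (gt_mem_nhds (by simpa using And.intro hε₀ hε₁))
      · have : Continuous fun q : EuclideanSpace ℝ (Fin 2) × ℝ × ℝ ↦ q.2.2 := by fun_prop
        exact this.continuousAt.eventually (lt_mem_nhds (by norm_num))
    rw [← hes] at h1
    exact hcsymm.eventually h1
  refine ⟨min ε₀ ε₁, lt_min hε₀ hε₁, τ, ?_, by simp [hτ, hes], ?_⟩
  · filter_upwards [htarget] with y hy
    have : ContinuousAt (fun y : ThreeSphere ↦ e.symm y) y :=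
      ContinuousAt.comp (f := ((↑) : ThreeSphere → EuclideanSpace ℝ (Fin 4)))
        (e.continuousAt_symm hy) hval.continuousAt
    exact (continuousAt_fst.comp (continuousAt_snd.comp this)).neg
  filter_upwards [htarget, hV, hsymm] with y hyt hyV hys
  have hright := e.right_inv hyt
  rw [he_coe] at hright
  set q := e.symm y with hq
  -- Both `y` and `σ q.1` have norm one, so `|1 + r| = 1`, and `r > -1`.
  have hr : q.2.2 = 0 := by
    have := congrArg norm hright
    rw [norm_smul, toricMap, norm_rot, norm_eq_of_mem_sphere,
      show ‖σ q.1‖ = 1 from norm_eq_of_mem_sphere (f (ψ.symm q.1)), mul_one,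
      Real.norm_eq_abs, abs_of_pos (by linarith [hys.2.2])] at this
    linarith
  rw [hr, add_zero, one_smul] at hright
  have hhit : toricFlow (τ y) y = f (ψ.symm q.1) := by
    have : y = toricFlow q.2.1 (f (ψ.symm q.1)) := Subtype.ext hright.symm
    rw [this, ← Flow.map_add, ← this]
    simp [hτ, ← hq]
  refine ⟨by simpa [hτ] using hys.2.1, fun t ht ↦ ⟨?_, ?_⟩⟩
  · rintro ⟨q', hq', hft⟩
    obtain ⟨hs', hA'⟩ := hVT y hyV t (hεT (by simpa using ht.trans_le (min_le_right _ _))) q' hft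
    have hsrc : (ψ q', -t, (0 : ℝ)) ∈ e.source := by
      refine hAB ⟨hA', hεB ?_⟩
      simpa [Prod.dist_eq, Real.dist_eq, hε₀] using ht.trans_le (min_le_left _ _)
    have hey : e (ψ q', -t, 0) = y := by
      rw [he_coe, add_zero, one_smul, hσ, Function.comp_apply, ψ.left_inv hs', hg]
      have : toricFlow (-t) (f q') = y := by rw [hft, ← Flow.map_add]; simp
      exact congrArg Subtype.val this
    have : q = (ψ q', -t, 0) := by rw [hq, ← hey, e.left_inv hsrc]
    simp [hτ, ← hq, this]
  · rintro rfl
    rw [hhit]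
    refine mem_image_of_mem _ ?_
    have hqt := interior_subset hys.1
    refine ((𝓡∂ 2).isInteriorPoint_iff_of_mem_atlas (n := ∞) (by simp) (chart_mem_atlas _ p)
      (x := ψ.symm q.1) ?_).2 ?_
    · have := ψ.map_target hqt
      rwa [hψ, extChartAt_source] at this
    · have := ψ.right_inv hqt
      change ψ (ψ.symm q.1) ∈ interior ψ.target
      rw [this]
      exact hys.1

end FlowBox

/-! ### A connected boundary lies on one level of the moment map -/

lemma toricReeb_ne_zero (x : ThreeSphere) : toricReeb x ≠ 0 := by
  intro h
  have := isReebVectorField_toricReeb.normalized x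
  simp only [h] at this
  rw [toricForm_apply] at this
  simp at this

/-- Orbits of the Reeb flow are locally injective. -/
lemma exists_injOn_toricFlow (x : ThreeSphere) :
    ∃ δ > 0, InjOn (fun t : ℝ ↦ toricFlow t x) (Ioo (-δ) δ) := by
  obtain ⟨i, hi⟩ : ∃ i, toricReeb x i ≠ 0 := by
    by_contra! h
    exact toricReeb_ne_zero x (by ext i; exact h i)
  have hc : ContDiff ℝ ∞ fun t : ℝ ↦ toricMap t x i := by
    have h1 : ContDiff ℝ ∞ fun t : ℝ ↦ toricMap t x :=
      contDiff_toricMap.comp (contDiff_id.prodMk contDiff_const)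
    exact (EuclideanSpace.proj i : EuclideanSpace ℝ (Fin 4) →L[ℝ] ℝ).contDiff.comp h1
  have hd : HasDerivAt (fun t : ℝ ↦ toricMap t x i) (toricReeb x i) 0 :=
    (EuclideanSpace.proj i : EuclideanSpace ℝ (Fin 4) →L[ℝ] ℝ).hasFDerivAt.comp_hasDerivAt 0
      (hasDerivAt_toricMap_zero x)
  have hs : HasStrictDerivAt (fun t : ℝ ↦ toricMap t x i) (toricReeb x i) 0 :=
    hc.contDiffAt.hasStrictDerivAt' hd (by simp)
  have he := hs.hasStrictFDerivAt_equiv hi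
  have hinj := (he.toOpenPartialHomeomorph _).injOn
  obtain ⟨δ, hδ, hδs⟩ := Metric.isOpen_iff.1 (he.toOpenPartialHomeomorph _).open_source 0
    he.mem_toOpenPartialHomeomorph_source
  refine ⟨δ, hδ, fun s hs t ht hst ↦ hinj (hδs ?_) (hδs ?_) ?_⟩
  · simpa [Real.dist_eq, abs_lt] using hs
  · simpa [Real.dist_eq, abs_lt] using ht
  · exact congrArg (fun y : ThreeSphere ↦ y.1 i) hst

/-- A continuous injective real function on an open interval around `0` is a local surjection. -/
lemma image_mem_nhds_of_injOn {k : ℝ → ℝ} {δ : ℝ} (hδ : 0 < δ) (hc : ContinuousOn k (Icc (-δ) δ))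
    (hinj : InjOn k (Icc (-δ) δ)) : k '' Icc (-δ) δ ∈ 𝓝 (k 0) := by
  have h0 : (0 : ℝ) ∈ Icc (-δ) δ := ⟨by linarith, hδ.le⟩
  have hl : -δ ∈ Icc (-δ) δ := ⟨le_rfl, by linarith⟩
  have hr : δ ∈ Icc (-δ) δ := ⟨by linarith, le_rfl⟩
  rcases hc.strictMonoOn_of_injOn_Icc' (by linarith) hinj with h | h
  · exact mem_of_superset (Icc_mem_nhds (h hl h0 (by linarith)) (h h0 hr hδ))
      (intermediate_value_Icc (by linarith) hc)
  · exact mem_of_superset (Icc_mem_nhds (h h0 hr hδ) (h hl h0 (by linarith)))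
      (intermediate_value_Icc' (by linarith) hc)

variable {M : Type} [TopologicalSpace M] [ChartedSpace (EuclideanHalfSpace 2) M]

/-- A positive first coordinate in any chart would make `q` an interior point, since being interior
does not depend on the chart. -/
lemma extChartAt_apply_zero_of_mem_boundary [IsManifold (𝓡∂ 2) ∞ M] {p q : M}
    (hq : q ∈ (𝓡∂ 2).boundary M) (hqp : q ∈ (extChartAt (𝓡∂ 2) p).source) :
    extChartAt (𝓡∂ 2) p q 0 = 0 := by
  have h1 : extChartAt (𝓡∂ 2) p q ∈ range (𝓡∂ 2) := mem_range_self _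
  have h2 := h1
  rw [range_modelWithCornersEuclideanHalfSpace] at h2
  refine le_antisymm ?_ h2
  by_contra! h3
  have h4 : extChartAt (𝓡∂ 2) p q ∈ interior (range (𝓡∂ 2)) := by
    rw [interior_range_modelWithCornersEuclideanHalfSpace]
    exact h3
  rw [extChartAt_source] at hqp
  have h5 : (𝓡∂ 2).IsInteriorPoint q :=
    ((𝓡∂ 2).isInteriorPoint_iff_of_mem_atlas (n := ∞) (by simp) (chart_mem_atlas _ p) hqp).2
      ((chartAt _ p).mem_interior_extend_target ((chartAt _ p).map_source hqp) h4)
  exact (((𝓡∂ 2).isInteriorPoint_iff_not_isBoundaryPoint q).1 h5) hq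

/-- In a chart the boundary is parametrized by the second coordinate alone. The orbit of `f p` runs
injectively inside the boundary, so in this coordinate it covers a neighbourhood, and the moment map
is constant along it. -/
lemma eventually_moment_eq [IsManifold (𝓡∂ 2) ∞ M] {f : M → ThreeSphere} (hf : IsEmbedding f)
    (hinv : ∀ p ∈ (𝓡∂ 2).boundary M, ∀ t : ℝ, toricFlow t (f p) ∈ f '' (𝓡∂ 2).boundary M)
    {p : M} (hp : p ∈ (𝓡∂ 2).boundary M) :
    ∀ᶠ q in 𝓝 p, q ∈ (𝓡∂ 2).boundary M → moment (f q) = moment (f p) := by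
  choose c hcb hcf using hinv p hp
  have hcc : Continuous c := by
    rw [hf.continuous_iff, show f ∘ c = fun t ↦ toricFlow t (f p) from funext hcf]
    exact toricFlow.continuous continuous_id continuous_const
  have hc0 : c 0 = p := hf.injective (by rw [hcf]; simp)
  set ψ := extChartAt (𝓡∂ 2) p with hψ
  obtain ⟨δ, hδ, hinj⟩ := exists_injOn_toricFlow (f p)
  have hsrc : ∀ᶠ t in 𝓝 (0 : ℝ), c t ∈ ψ.source :=
    hcc.continuousAt.eventually (by rw [hc0]; exact extChartAt_source_mem_nhds p)
  obtain ⟨δ', hδ', hs⟩ := Metric.eventually_nhds_iff_ball.1 hsrc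
  set η := min δ δ' / 2 with hη
  have hηpos : 0 < η := by have := lt_min hδ hδ'; positivity
  have hη1 : η < δ := by have := min_le_left δ δ'; linarith [lt_min hδ hδ']
  have hη2 : η < δ' := by have := min_le_right δ δ'; linarith [lt_min hδ hδ']
  have hsη : ∀ t ∈ Icc (-η) η, c t ∈ ψ.source := fun t ht ↦ hs t (by
    rw [Metric.mem_ball, Real.dist_eq, sub_zero, abs_lt]; constructor <;> linarith [ht.1, ht.2])
  have hzero : ∀ q ∈ (𝓡∂ 2).boundary M, q ∈ ψ.source → ψ q 0 = 0 := fun q hq hqp ↦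
    extChartAt_apply_zero_of_mem_boundary hq hqp
  have heq : ∀ q ∈ (𝓡∂ 2).boundary M, q ∈ ψ.source → ∀ q' ∈ (𝓡∂ 2).boundary M, q' ∈ ψ.source →
      ψ q 1 = ψ q' 1 → q = q' := by
    intro q hq hqs q' hq' hqs' h
    refine ψ.injOn hqs hqs' ?_
    ext i
    fin_cases i
    · exact (hzero q hq hqs).trans (hzero q' hq' hqs').symm
    · exact h
  have hproj : Continuous fun u : EuclideanSpace ℝ (Fin 2) ↦ u 1 := by fun_prop
  have himg : (fun t ↦ ψ (c t) 1) '' Icc (-η) η ∈ 𝓝 (ψ (c 0) 1) := by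
    refine image_mem_nhds_of_injOn (k := fun t ↦ ψ (c t) 1) hηpos ?_ ?_
    · exact hproj.comp_continuousOn ((continuousOn_extChartAt p).comp hcc.continuousOn hsη)
    · intro s hs t ht hst
      have := heq _ (hcb s) (hsη s hs) _ (hcb t) (hsη t ht) hst
      refine hinj ⟨by linarith [hs.1], by linarith [hs.2]⟩ ⟨by linarith [ht.1], by linarith [ht.2]⟩ ?_
      simp only [← hcf, this]
  rw [hc0] at himg
  have hcont : ContinuousAt (fun q ↦ ψ q 1) p :=
    hproj.continuousAt.comp (continuousAt_extChartAt (I := 𝓡∂ 2) p)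
  filter_upwards [hcont.eventually himg, extChartAt_source_mem_nhds (I := 𝓡∂ 2) p] with q hq hqs hqb
  obtain ⟨t, ht, htq⟩ := hq
  rw [← heq _ (hcb t) (hsη t ht) _ hqb hqs htq, hcf, coe_toricFlow, moment_toricMap]

/-- A connected boundary made of orbits lies on one level of the moment map. -/
lemma exists_moment_eq [IsManifold (𝓡∂ 2) ∞ M] {f : M → ThreeSphere} (hf : IsEmbedding f)
    (hinv : ∀ p ∈ (𝓡∂ 2).boundary M, ∀ t : ℝ, toricFlow t (f p) ∈ f '' (𝓡∂ 2).boundary M)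
    (hconn : HasOneBoundaryComponent M) :
    ∃ m, ∀ p ∈ (𝓡∂ 2).boundary M, moment (f p) = m := by
  obtain ⟨⟨p₀, hp₀⟩, hpre⟩ := hconn
  refine ⟨moment (f p₀), fun p hp ↦ ?_⟩
  have : PreconnectedSpace ((𝓡∂ 2).boundary M) := Subtype.preconnectedSpace hpre
  have hloc : IsLocallyConstant fun q : (𝓡∂ 2).boundary M ↦ moment (f q) := by
    rw [IsLocallyConstant.iff_eventually_eq]
    intro q
    filter_upwards [continuous_subtype_val.continuousAt.eventually
      (eventually_moment_eq hf hinv q.2)] with q' hq'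
    exact hq' q'.2
  exact hloc.apply_eq_of_preconnectedSpace ⟨p, hp⟩ ⟨p₀, hp₀⟩

/-! ### The boundary of a disk-like surface -/

section Disk

lemma exists_continuous_rightInverse {M : Type*} [TopologicalSpace M] [T2Space M]
    {g : EuclideanSpace ℝ (Fin 2) → M}
    (hg : ContinuousOn g (closedBall 0 1)) (hbij : BijOn g (closedBall 0 1) univ) :
    ∃ G : M → EuclideanSpace ℝ (Fin 2), Continuous G ∧ (∀ q, G q ∈ closedBall 0 1) ∧
      ∀ q, g (G q) = q := by
  have : CompactSpace (closedBall (0 : EuclideanSpace ℝ (Fin 2)) 1) :=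
    isCompact_iff_compactSpace.1 (isCompact_closedBall _ _)
  have hb : Function.Bijective ((closedBall (0 : EuclideanSpace ℝ (Fin 2)) 1).domRestrict g) := by
    refine ⟨injOn_iff_injective.1 hbij.injOn, fun q ↦ ?_⟩
    obtain ⟨x, hx, hxq⟩ := hbij.surjOn (mem_univ q)
    exact ⟨⟨x, hx⟩, hxq⟩
  have hc : Continuous (Equiv.ofBijective _ hb) := hg.domRestrict
  let e := hc.homeoOfEquivCompactToT2
  exact ⟨fun q ↦ e.symm q, continuous_subtype_val.comp e.symm.continuous, fun q ↦ (e.symm q).2,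
    fun q ↦ e.apply_symm_apply q⟩

variable {M : Type} [TopologicalSpace M] [ChartedSpace (EuclideanHalfSpace 2) M]

lemma isInteriorPoint_of_mem_ball {g : EuclideanSpace ℝ (Fin 2) → M}
    [IsManifold (𝓡∂ 2) ∞ M] {x : EuclideanSpace ℝ (Fin 2)}
    (hg : ContMDiffOn 𝓘(ℝ, EuclideanSpace ℝ (Fin 2)) (𝓡∂ 2) ∞ g (closedBall 0 1))
    (hx : x ∈ ball (0 : EuclideanSpace ℝ (Fin 2)) 1)
    (hs : Function.Surjective
      (mfderivWithin 𝓘(ℝ, EuclideanSpace ℝ (Fin 2)) (𝓡∂ 2) g (closedBall 0 1) x)) :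
    (𝓡∂ 2).IsInteriorPoint (g x) := by
  have hnhds : closedBall (0 : EuclideanSpace ℝ (Fin 2)) 1 ∈ 𝓝 x :=
    mem_of_superset (isOpen_ball.mem_nhds hx) ball_subset_closedBall
  rw [mfderivWithin_of_mem_nhds hnhds] at hs
  exact MDifferentiableAt.isInteriorPoint_of_surjective_mfderiv
    ((hg.contMDiffAt hnhds).mdifferentiableAt (by simp)) hs BoundarylessManifold.isInteriorPoint

/-- If `g x` were interior, the inverse `k` of `g` in a chart would be differentiable at an interior
point with invertible differential, while `‖k‖²` has a maximum there because `k` takes values in the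
disk. Its derivative `2⟪x, dk⟫` would vanish, which is impossible for `x ≠ 0`. -/
lemma isBoundaryPoint_of_mem_sphere [T2Space M] {g : EuclideanSpace ℝ (Fin 2) → M}
    (hg : ContMDiffOn 𝓘(ℝ, EuclideanSpace ℝ (Fin 2)) (𝓡∂ 2) ∞ g (closedBall 0 1))
    (hbij : BijOn g (closedBall 0 1) univ) {x : EuclideanSpace ℝ (Fin 2)}
    (hx : x ∈ sphere (0 : EuclideanSpace ℝ (Fin 2)) 1)
    (hs : Function.Bijective
      (mfderivWithin 𝓘(ℝ, EuclideanSpace ℝ (Fin 2)) (𝓡∂ 2) g (closedBall 0 1) x)) :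
    (𝓡∂ 2).IsBoundaryPoint (g x) := by
  rw [ModelWithCorners.isBoundaryPoint_iff_not_isInteriorPoint]
  intro hint
  have hxb : x ∈ closedBall (0 : EuclideanSpace ℝ (Fin 2)) 1 := sphere_subset_closedBall hx
  obtain ⟨G, hGc, hGb, hG⟩ := exists_continuous_rightInverse hg.continuousOn hbij
  have hGx : G (g x) = x := hbij.injOn (hGb _) hxb (hG _)
  set ψ := extChartAt (𝓡∂ 2) (g x) with hψ
  obtain ⟨D, hDb, hD⟩ : ∃ D : EuclideanSpace ℝ (Fin 2) →L[ℝ] EuclideanSpace ℝ (Fin 2),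
      Function.Bijective D ∧ HasFDerivWithinAt (ψ ∘ g) D (closedBall 0 1) x := by
    refine ⟨_, hs, ?_⟩
    have h1 := ((hg x hxb).mdifferentiableWithinAt (by simp)).hasMFDerivWithinAt.2
    have h2 : (extChartAt 𝓘(ℝ, EuclideanSpace ℝ (Fin 2)) x).symm ⁻¹' (closedBall 0 1) ∩
        range 𝓘(ℝ, EuclideanSpace ℝ (Fin 2)) = closedBall 0 1 := by
      simp only [mfld_simps]
      rfl
    rw [h2] at h1
    exact h1
  let A : EuclideanSpace ℝ (Fin 2) ≃L[ℝ] EuclideanSpace ℝ (Fin 2) :=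
    (LinearEquiv.ofBijective (D : EuclideanSpace ℝ (Fin 2) →ₗ[ℝ] EuclideanSpace ℝ (Fin 2))
      hDb).toContinuousLinearEquiv
  have hdA : HasFDerivWithinAt (ψ ∘ g)
      (A : EuclideanSpace ℝ (Fin 2) →L[ℝ] EuclideanSpace ℝ (Fin 2)) (closedBall 0 1) x := hD
  set u₀ := ψ (g x)
  set k := G ∘ ψ.symm
  have hk0 : k u₀ = x := by
    simp only [k, u₀, Function.comp_apply]
    rw [ψ.left_inv (mem_extChartAt_source _), hGx]
  have hkb : ∀ u, k u ∈ closedBall (0 : EuclideanSpace ℝ (Fin 2)) 1 := fun u ↦ hGb _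
  have hkc : ContinuousAt k u₀ := hGc.continuousAt.comp (continuousAt_extChartAt_symm (g x))
  have htarget : ψ.target ∈ 𝓝 u₀ := by
    have := extChartAt_target_mem_nhdsWithin (I := 𝓡∂ 2) (g x)
    rwa [nhdsWithin_eq_nhds.2 (range_mem_nhds_isInteriorPoint hint)] at this
  have hk : HasFDerivAt k (A.symm : EuclideanSpace ℝ (Fin 2) →L[ℝ] EuclideanSpace ℝ (Fin 2)) u₀ := by
    rw [← hasFDerivWithinAt_univ]
    refine HasFDerivWithinAt.of_local_left_inverse (t := closedBall 0 1) (f := ψ ∘ g) ?_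
      (by rw [hk0]; exact hdA) (mem_univ _) ?_
    · rw [nhdsWithin_univ]
      exact tendsto_nhdsWithin_iff.2 ⟨hkc, Eventually.of_forall hkb⟩
    · rw [nhdsWithin_univ]
      filter_upwards [htarget] with u hu
      simp only [k, Function.comp_apply, hG]
      exact ψ.right_inv hu
  have hmax : IsLocalMax (fun u ↦ ‖k u‖ ^ 2) u₀ := by
    refine Eventually.of_forall fun u ↦ ?_
    have h1 := hkb u
    rw [mem_closedBall_zero_iff] at h1
    simp only [hk0, mem_sphere_zero_iff_norm.1 hx]
    gcongr
  have h0 := hmax.hasFDerivAt_eq_zero hk.norm_sq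
  have h1 := congrArg (fun L ↦ L (A x)) h0
  simp [hk0, mem_sphere_zero_iff_norm.1 hx] at h1

/-- The boundary of a disk is connected. -/
lemma IsDiskLike.hasOneBoundaryComponent [T2Space M] [IsManifold (𝓡∂ 2) ∞ M] (h : IsDiskLike M) :
    HasOneBoundaryComponent M := by
  obtain ⟨g, hg, hbij, hd⟩ := h
  have hb : (𝓡∂ 2).boundary M = g '' sphere 0 1 := by
    ext q
    constructor
    · intro hq
      obtain ⟨x, hx, rfl⟩ := hbij.surjOn (mem_univ q)
      refine ⟨x, ?_, rfl⟩
      by_contra hxs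
      have hxb : x ∈ ball (0 : EuclideanSpace ℝ (Fin 2)) 1 := by
        rw [← closedBall_sdiff_sphere]; exact ⟨hx, hxs⟩
      exact ((𝓡∂ 2).isInteriorPoint_iff_not_isBoundaryPoint _).1
        (isInteriorPoint_of_mem_ball hg hxb (hd x hx).2) hq
    · rintro ⟨x, hx, rfl⟩
      exact isBoundaryPoint_of_mem_sphere hg hbij hx (hd x (sphere_subset_closedBall hx))
  rw [HasOneBoundaryComponent, hb]
  refine IsConnected.image (isConnected_sphere ?_ 0 zero_le_one) g
    (hg.continuousOn.mono sphere_subset_closedBall)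
  rw [← Module.finrank_eq_rank]
  simp

end Disk

/-! ### Spanning disks and the contradiction -/

/-- A periodic orbit of a flow with a section does not bound a disk. -/
lemma IsTopologicalSection.not_bounds_disk {X : Type*} [TopologicalSpace X] {φ : Flow ℝ X}
    {H : Set X} (h : IsTopologicalSection φ H) {F : closedBall (0 : ℂ) 1 → X} (hF : Continuous F)
    {x : X} {T : ℝ} (hT : T ≠ 0)
    (hper : ∀ (s : ℝ) (w : closedBall (0 : ℂ) 1),
      (w : ℂ) = Complex.exp (2 * Real.pi * s * Complex.I) → F w = φ (s * T) x) : False := by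
  have hexp (s : ℝ) : ‖Complex.exp (2 * Real.pi * s * Complex.I)‖ = 1 := by
    have := Complex.norm_exp_ofReal_mul_I (2 * Real.pi * s)
    push_cast at this
    exact this
  -- The unit circle is contracted linearly to its base point `1`, which stays fixed throughout.
  let c : unitInterval × unitInterval → closedBall (0 : ℂ) 1 := fun p ↦
    ⟨(1 - (p.1 : ℝ) : ℝ) • Complex.exp (2 * Real.pi * (p.2 : ℝ) * Complex.I) + (p.1 : ℝ) • (1 : ℂ),
      (convex_closedBall (0 : ℂ) 1) (by simp [hexp]) (by simp) (by linarith [p.1.2.2])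
      p.1.2.1 (by simp)⟩
  have hc : Continuous c := by
    refine Continuous.subtype_mk ?_ _
    fun_prop
  have h1 (w : closedBall (0 : ℂ) 1) (hw : (w : ℂ) = 1) : F w = x := by
    simpa using hper 0 w (by simpa using hw)
  have h0 (t : unitInterval) : F (c (0, t)) = φ (t * T) x := hper t _ (by simp [c])
  let γ : C(unitInterval, X) := ⟨fun t ↦ F (c (0, t)), by fun_prop⟩
  refine h.not_nullhomotopic hT (γ := γ) h0 ⟨⟨⟨⟨fun p ↦ F (c p), hF.comp hc⟩, fun t ↦ rfl,
    fun t ↦ h1 _ (by simp [c])⟩, ?_⟩⟩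
  rintro s t ht
  have hct (s : unitInterval) : (c (s, t) : ℂ) = 1 := by
    have : Complex.exp (2 * Real.pi * (t : ℝ) * Complex.I) = 1 := by
      rcases ht with rfl | rfl
      · simp
      · simp [Complex.exp_two_pi_mul_I]
    simp [c, this]
  exact (h1 _ (hct s)).trans (h1 _ (hct 0)).symm

section Section

variable {M : Type} [TopologicalSpace M] [ChartedSpace (EuclideanHalfSpace 2) M]
  [IsManifold (𝓡∂ 2) ∞ M] [CompactSpace M] [ConnectedSpace M] {f : M → ThreeSphere}

lemma isInvariant_compl_boundary
    (h : IsGlobalSurfaceOfSection (fun x : ThreeSphere ↦ toricReeb x) toricFlow M f) :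
    IsInvariant toricFlow (f '' (𝓡∂ 2).boundary M)ᶜ := by
  rintro t x hx ⟨p, hp, hpx⟩
  refine hx ?_
  have := (h.boundary_periodic p hp).2 (-t)
  rwa [hpx, ← Flow.map_add, neg_add_cancel, Flow.map_zero_apply] at this

/-- The flow is restricted to the complement of the boundary. There the interior is closed, being
the trace of the compact set `f(M)`. -/
lemma isTopologicalSection_of_isGlobalSurfaceOfSection
    (h : IsGlobalSurfaceOfSection (fun x : ThreeSphere ↦ toricReeb x) toricFlow M f) :
    IsTopologicalSection (toricFlow.restrict (isInvariant_compl_boundary h))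
      (Subtype.val ⁻¹' (f '' (𝓡∂ 2).interior M)) where
  isClosed := by
    have : (Subtype.val ⁻¹' (f '' (𝓡∂ 2).interior M) : Set ↥(f '' (𝓡∂ 2).boundary M)ᶜ) =
        Subtype.val ⁻¹' range f := by
      ext ⟨x, hx⟩
      constructor
      · rintro ⟨p, -, hp⟩
        exact ⟨p, hp⟩
      · rintro ⟨p, hp⟩
        refine ⟨p, ?_, hp⟩
        rw [← (𝓡∂ 2).compl_boundary]
        exact fun hb ↦ hx ⟨p, hb, hp⟩
    rw [this]
    exact (isCompact_range h.embedding.contMDiff.continuous).isClosed.preimage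
      continuous_subtype_val
  flowBox := by
    rintro ⟨x, hx⟩ ⟨p, hp, rfl⟩
    obtain ⟨ε, hε, τ, hc, h0, hτ⟩ := exists_flowBox h.embedding hp (h.transverse p hp)
    have hv : Tendsto Subtype.val (𝓝 (⟨f p, hx⟩ : ↥(f '' (𝓡∂ 2).boundary M)ᶜ)) (𝓝 (f p)) :=
      continuous_subtype_val.tendsto _
    refine ⟨ε, hε, fun y ↦ τ y, ?_, h0, ?_⟩
    · filter_upwards [hv.eventually hc] with y hy
      exact ContinuousAt.comp (f := Subtype.val) hy continuous_subtype_val.continuousAt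
    · filter_upwards [hv.eventually hτ] with y hy
      exact hy
  forward x := h.hits_forward x x.2
  backward x := h.hits_backward x x.2

lemma norm_eq_one_of_sum_sq {x : EuclideanSpace ℝ (Fin 4)}
    (h : x 0 ^ 2 + x 1 ^ 2 + x 2 ^ 2 + x 3 ^ 2 = 1) : ‖x‖ = 1 := by
  rw [EuclideanSpace.norm_eq, Real.sqrt_eq_one]
  simpa [Fin.sum_univ_four] using h

lemma sum_sq_of_mem_closedBall (w : closedBall (0 : ℂ) 1) : w.1.re ^ 2 + w.1.im ^ 2 ≤ 1 := by
  have h := mem_closedBall_zero_iff.1 w.2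
  have := Complex.sq_norm w.1
  rw [Complex.normSq_apply] at this
  nlinarith [norm_nonneg w.1]

/-- The disk in the three-sphere with `z₁ ≥ 0` that bounds a periodic orbit on the level `1 / 3`
of the moment map. -/
noncomputable def upperDisk (w : closedBall (0 : ℂ) 1) : ThreeSphere :=
  ⟨!₂[√(1 - (w.1.re ^ 2 + w.1.im ^ 2) / 3), 0, w.1.re / √3, w.1.im / √3], by
    have h := sum_sq_of_mem_closedBall w
    refine mem_sphere_zero_iff_norm.2 (norm_eq_one_of_sum_sq ?_)
    simp [div_pow]
    rw [Real.sq_sqrt (by linarith)]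
    ring⟩

/-- The disk in the three-sphere with `z₂ ≥ 0` that bounds a periodic orbit on the level `-1 / 3`
of the moment map. -/
noncomputable def lowerDisk (w : closedBall (0 : ℂ) 1) : ThreeSphere :=
  ⟨!₂[w.1.re / √3, w.1.im / √3, √(1 - (w.1.re ^ 2 + w.1.im ^ 2) / 3), 0], by
    have h := sum_sq_of_mem_closedBall w
    refine mem_sphere_zero_iff_norm.2 (norm_eq_one_of_sum_sq ?_)
    simp [div_pow]
    rw [Real.sq_sqrt (by linarith)]
    ring⟩

lemma moment_upperDisk (w : closedBall (0 : ℂ) 1) :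
    moment (upperDisk w) = 1 - 2 * (w.1.re ^ 2 + w.1.im ^ 2) / 3 := by
  have h := sum_sq_of_mem_closedBall w
  simp [moment, upperDisk, div_pow]
  rw [Real.sq_sqrt (by linarith)]
  ring

lemma moment_lowerDisk (w : closedBall (0 : ℂ) 1) :
    moment (lowerDisk w) = 2 * (w.1.re ^ 2 + w.1.im ^ 2) / 3 - 1 := by
  have h := sum_sq_of_mem_closedBall w
  simp [moment, lowerDisk, div_pow]
  rw [Real.sq_sqrt (by linarith)]
  ring

lemma continuous_upperDisk : Continuous upperDisk := by
  refine Continuous.subtype_mk ((PiLp.continuous_toLp 2 _).comp (continuous_pi fun i ↦ ?_)) _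
  fin_cases i <;> simp <;> fun_prop

lemma continuous_lowerDisk : Continuous lowerDisk := by
  refine Continuous.subtype_mk ((PiLp.continuous_toLp 2 _).comp (continuous_pi fun i ↦ ?_)) _
  fin_cases i <;> simp <;> fun_prop

lemma exp_re_im {s : ℝ} {w : ℂ} (hw : w = Complex.exp (2 * Real.pi * s * Complex.I)) :
    w.re = Real.cos (2 * Real.pi * s) ∧ w.im = Real.sin (2 * Real.pi * s) := by
  have : w = Complex.exp ((2 * Real.pi * s : ℝ) * Complex.I) := by rw [hw]; push_cast; rfl
  rw [this]
  exact ⟨Complex.exp_ofReal_mul_I_re _, Complex.exp_ofReal_mul_I_im _⟩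

/-- On the circle `|w| = 1` one has `m = 1/3`: the first speed vanishes and the second is `9/4`, so
the period is `2π / (9/4) = 8π/9`. -/
lemma upperDisk_eq_toricFlow {s : ℝ} {w : closedBall (0 : ℂ) 1}
    (hw : (w : ℂ) = Complex.exp (2 * Real.pi * s * Complex.I)) :
    upperDisk w = toricFlow (s * (8 * Real.pi / 9)) (upperDisk ⟨1, by simp⟩) := by
  obtain ⟨hr, hi⟩ := exp_re_im hw
  have hm : moment (upperDisk ⟨1, by simp⟩) = 1 / 3 := by
    rw [moment_upperDisk]; norm_num
  have ha : angularSpeed (1 / 3) * (s * (8 * Real.pi / 9)) = 0 := by norm_num [angularSpeed]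
  have hb : angularSpeed (-(1 / 3)) * (s * (8 * Real.pi / 9)) = 2 * Real.pi * s := by
    norm_num [angularSpeed]; ring
  refine Subtype.ext ?_
  rw [coe_toricFlow, toricMap, hm, ha, hb]
  ext i
  fin_cases i <;> simp [upperDisk, rot, hr, hi] <;> ring

lemma lowerDisk_eq_toricFlow {s : ℝ} {w : closedBall (0 : ℂ) 1}
    (hw : (w : ℂ) = Complex.exp (2 * Real.pi * s * Complex.I)) :
    lowerDisk w = toricFlow (s * (8 * Real.pi / 9)) (lowerDisk ⟨1, by simp⟩) := by
  obtain ⟨hr, hi⟩ := exp_re_im hw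
  have hm : moment (lowerDisk ⟨1, by simp⟩) = -(1 / 3) := by
    rw [moment_lowerDisk]; norm_num
  have ha : angularSpeed (-(1 / 3)) * (s * (8 * Real.pi / 9)) = 2 * Real.pi * s := by
    norm_num [angularSpeed]; ring
  have hb : angularSpeed (- -(1 / 3)) * (s * (8 * Real.pi / 9)) = 0 := by norm_num [angularSpeed]
  refine Subtype.ext ?_
  rw [coe_toricFlow, toricMap, hm, ha, hb]
  ext i
  fin_cases i <;> simp [lowerDisk, rot, hr, hi] <;> ring

/-- If a periodic orbit of the Reeb flow bounds a disk, then the disk meets the boundary of every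
global surface of section. -/
lemma exists_disk_mem_boundary
    (h : IsGlobalSurfaceOfSection (fun x : ThreeSphere ↦ toricReeb x) toricFlow M f)
    {d : closedBall (0 : ℂ) 1 → ThreeSphere} (hd : Continuous d)
    (hper : ∀ (s : ℝ) (w : closedBall (0 : ℂ) 1),
      (w : ℂ) = Complex.exp (2 * Real.pi * s * Complex.I) →
        d w = toricFlow (s * (8 * Real.pi / 9)) (d ⟨1, by simp⟩)) :
    ∃ w, d w ∈ f '' (𝓡∂ 2).boundary M := by
  by_contra! hmem
  refine (isTopologicalSection_of_isGlobalSurfaceOfSection h).not_bounds_disk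
    (F := fun w ↦ ⟨d w, hmem w⟩) (hd.subtype_mk _) (x := ⟨d ⟨1, by simp⟩, hmem _⟩)
    (T := 8 * Real.pi / 9) (by positivity) fun s w hw ↦ Subtype.ext (hper s w hw)

theorem not_hasOneBoundaryComponent
    (h : IsGlobalSurfaceOfSection (fun x : ThreeSphere ↦ toricReeb x) toricFlow M f) :
    ¬ HasOneBoundaryComponent M := by
  intro hone
  obtain ⟨m, hm⟩ := exists_moment_eq h.embedding.isEmbedding
    (fun p hp ↦ (h.boundary_periodic p hp).2) hone
  obtain ⟨w, p, hp, hpw⟩ := exists_disk_mem_boundary h continuous_upperDisk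
    fun s w ↦ upperDisk_eq_toricFlow
  obtain ⟨w', p', hp', hpw'⟩ := exists_disk_mem_boundary h continuous_lowerDisk
    fun s w ↦ lowerDisk_eq_toricFlow
  have h1 := hm p hp
  have h2 := hm p' hp'
  rw [hpw, moment_upperDisk] at h1
  rw [hpw', moment_lowerDisk] at h2
  -- The upper disk forces `m ≥ 1/3` and the lower one `m ≤ -1/3`.
  linarith [sum_sq_of_mem_closedBall w, sum_sq_of_mem_closedBall w']

end Section

theorem mainTheorem1 :
    ∃ (α : EuclideanSpace ℝ (Fin 4) → EuclideanSpace ℝ (Fin 4) [⋀^Fin 1]→L[ℝ] ℝ)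
      (R : ThreeSphere → EuclideanSpace ℝ (Fin 4)) (φ : Flow ℝ ThreeSphere),
      IsContactFormOnSphere α ∧
      (∀ x : ThreeSphere, {v | v ∈ tangentPlane x ∧ α x ![v] = 0} = standardContactPlane x) ∧
      IsReebVectorField α R ∧
      IsFlowOf R φ ∧
      (∀ (M : Type) [TopologicalSpace M] [ChartedSpace (EuclideanHalfSpace 2) M]
        [IsManifold (𝓡∂ 2) ∞ M] [CompactSpace M] [ConnectedSpace M] (f : M → ThreeSphere),
        IsGlobalSurfaceOfSection R φ M f → ¬ HasOneBoundaryComponent M) ∧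
      (∀ (M : Type) [TopologicalSpace M] [ChartedSpace (EuclideanHalfSpace 2) M]
        [IsManifold (𝓡∂ 2) ∞ M] [CompactSpace M] [ConnectedSpace M] (f : M → ThreeSphere),
        IsGlobalSurfaceOfSection R φ M f → ¬ IsDiskLike M) := by
  refine ⟨toricForm, fun x ↦ toricReeb x, toricFlow, isContactFormOnSphere_toricForm, ker_toricForm,
    isReebVectorField_toricReeb, isFlowOf_toricFlow, ?_, ?_⟩
  · intro M _ _ _ _ _ f h
    exact not_hasOneBoundaryComponent h
  · intro M _ _ _ _ _ f h hdisk
    -- `M` inherits the Hausdorff property from the sphere through the embedding.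
    have : T2Space M := h.embedding.isEmbedding.t2Space
    exact not_hasOneBoundaryComponent h hdisk.hasOneBoundaryComponent
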